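/- **Conventions.** Let $\langle\cdot,\cdot\rangle$ be the standard pairing of natural numbers; the natural number $\langle a,\langle b,c\rangle\rangle$ codes the rational number $(a-b)/(c+1)$ (so every natural number codes a rational, and every rational has a code). Triples, quadruples and finite subsets of $\mathbb N$ are coded by natural numbers in the standard way. Let $\mathcal U$ be the free non-unital $*$-algebra over $\mathbb Q(i)$ on indeterminates $x_0,x_1,\dots$, and let $(\mathfrak p_j)_{j\in\mathbb N}$ be the standard effective enumeration of $\mathcal U$ (by codes of finite sums of terms, each term being a coefficient in $\mathbb Q(i)$ times a nonempty word in the letters $x_n, x_n^*$). A *presentation* $A^\#=(A,(u_n)_{n\in\mathbb N})$ of a $C^*$-algebra $A$ is a sequence $(u_n)$ in $A$ that generates a dense (not necessarily unital) $*$-subalgebra of $A$. The *$j$-th rational vector* $\mathfrak p_j[A^\#]$ is obtained from $\mathfrak p_j$ by substituting $u_n$ for $x_n$. A *name* of $A^\#$ is an $f\in\mathbb N^{\mathbb N}$ such that the set of triples coded by the numbers $f(0),f(1),\dots$ is exactly $$D(A^\#)=\{(r,j,r') : r,r'\in\mathbb Q\cap(0,\infty),\ j\in\mathbb N,\ r<\|\mathfrak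 p_j[A^\#]\|<r'\}.$$ An *$A^\#$-name* of a vector $v\in A$ is a $g\in\mathbb N^{\mathbb N}$ with $\|\mathfrak p_{g(k)}[A^\#]-v\|<2^{-k}$ for all $k\in\mathbb N$. A *presentation* $X^\#=(X,d,(s_j)_{j\in\mathbb N})$ of a Polish space $X$ consists of a complete metric $d$ that induces the topology of $X$ and a dense sequence $(s_j)$ in $X$. A *name* of $X^\#$ is an $h\in\mathbb N^{\mathbb N}$ such that the set of quadruples coded by the numbers $h(0),h(1),\dots$ is exactly $$D(X^\#)=\{(r,j,k,r') : r,r'\in\mathbb Q,\ j,k\in\mathbb N,\ r<d(s_j,s_k)<r'\}.$$ A *total boundedness function* of $X^\#$ is a $b\in\mathbb N^{\mathbb N}$ such that, for every $j\in\mathbb N$, $b(j)$ is a code of a finite set $F\subseteq\mathbb N$ with $X=\bigcup_{k\in F}B(s_k;2^{-j})$, where $B(s;\rho)$ is the open $d$-ball. For a commutative unital $C^*$-algebra $A$, the *spectrum* $\Delta(A)$ is the set of nonzero (multiplicative linear) homomorphisms $A\to\mathbb C$ with the Gelfand topology, i.e. the weakest topology in which all evaluation maps are continuous. **Theorem.**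 There is a single oracle Turing machine $M$ with the following property. Let $A$ be any commutative unital $C^*$-algebra, $A^\#$ any presentation of $A$, $f$ any name of $A^\#$ and $g$ any $A^\#$-name of the unit $\mathbf 1_A$. Then $M$, run with the oracle $(f,g)$, computes a pair $(h,b)$ of total functions $\mathbb N\to\mathbb N$ such that, for some presentation $\Delta(A)^\#$ of $\Delta(A)$, $h$ is a name of $\Delta(A)^\#$ and $b$ is a total boundedness function of $\Delta(A)^\#$. (The zero algebra needs no exclusion: its diagram is empty, so its presentations have no name.) -/

import Mathlib

universe u

/-! ### Oracle computations -/

/-- Programs for oracle computations on natural numbers: the codes for partial recursive functions,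
together with one instruction `oracle` that queries an oracle `ℕ → ℕ`. -/
inductive OracleMachine : Type
  | zero : OracleMachine
  | succ : OracleMachine
  | left : OracleMachine
  | right : OracleMachine
  | oracle : OracleMachine
  | pair : OracleMachine → OracleMachine → OracleMachine
  | comp : OracleMachine → OracleMachine → OracleMachine
  | prec : OracleMachine → OracleMachine → OracleMachine
  | rfind : OracleMachine → OracleMachine

namespace OracleMachine

/-- The partial function that a program computes when it is run with the oracle `O`. -/
def eval (O : ℕ → ℕ) : OracleMachine → ℕ →. ℕ
  | zero => fun _ => Part.some 0
  | succ => fun n => Part.some (n + 1)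
  | left => fun n => Part.some n.unpair.1
  | right => fun n => Part.some n.unpair.2
  | oracle => fun n => Part.some (O n)
  | pair c e => fun n => Nat.pair <$> eval O c n <*> eval O e n
  | comp c e => fun n => eval O e n >>= eval O c
  | prec c e => fun p =>
      Nat.rec (motive := fun _ => Part ℕ) (eval O c p.unpair.1)
        (fun y IH => IH >>= fun i => eval O e (Nat.pair p.unpair.1 (Nat.pair y i))) p.unpair.2
  | rfind c => fun a => Nat.rfind fun n => (fun m => decide (m = 0)) <$> eval O c (Nat.pair a n)

/-- With oracle `F`, the program halts on every input and computes the total function `G`. -/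
def Computes (c : OracleMachine) (F G : ℕ → ℕ) : Prop :=
  ∀ n, G n ∈ c.eval F n

/-- The programs, run with the oracle `O`, compute exactly the partial functions that are
recursive in `O`. -/
theorem recursiveIn_iff (O : ℕ → ℕ) (φ : ℕ →. ℕ) :
    Nat.RecursiveIn {(O : ℕ →. ℕ)} φ ↔ ∃ c : OracleMachine, c.eval O = φ := by
  constructor
  · intro h
    induction h with
    | zero => exact ⟨zero, rfl⟩
    | succ => exact ⟨succ, rfl⟩
    | left => exact ⟨left, rfl⟩
    | right => exact ⟨right, rfl⟩
    | oracle g hg =>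
      rw [Set.mem_singleton_iff] at hg
      exact ⟨oracle, hg.symm⟩
    | pair _ _ h₁ h₂ =>
      obtain ⟨c, rfl⟩ := h₁
      obtain ⟨e, rfl⟩ := h₂
      exact ⟨pair c e, rfl⟩
    | comp _ _ h₁ h₂ =>
      obtain ⟨c, rfl⟩ := h₁
      obtain ⟨e, rfl⟩ := h₂
      exact ⟨comp c e, rfl⟩
    | prec _ _ h₁ h₂ =>
      obtain ⟨c, rfl⟩ := h₁
      obtain ⟨e, rfl⟩ := h₂
      exact ⟨prec c e, rfl⟩
    | rfind _ h₁ =>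
      obtain ⟨c, rfl⟩ := h₁
      exact ⟨rfind c, rfl⟩
  · rintro ⟨c, rfl⟩
    induction c with
    | zero => exact .zero
    | succ => exact .succ
    | left => exact .left
    | right => exact .right
    | oracle => exact .oracle _ rfl
    | pair _ _ h₁ h₂ => exact .pair h₁ h₂
    | comp _ _ h₁ h₂ => exact .comp h₁ h₂
    | prec _ _ h₁ h₂ => exact .prec h₁ h₂
    | rfind _ h₁ => exact .rfind h₁

end OracleMachine

/-- The pair `⟨F, G⟩` of two points of Baire space as one point of Baire space: `F` on the even
numbers and `G` on the odd numbers. -/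
def bairePair (F G : ℕ → ℕ) (n : ℕ) : ℕ :=
  if n % 2 = 0 then F (n / 2) else G (n / 2)

/-- The rational number with code `n = ⟨a, ⟨b, c⟩⟩` is `(a - b) / (c + 1)`. -/
def ratOfCode (n : ℕ) : ℚ :=
  ((n.unpair.1 : ℚ) - (n.unpair.2.unpair.1 : ℚ)) / ((n.unpair.2.unpair.2 : ℚ) + 1)

/-! ### Presentations of C*-algebras -/

/-- Rational `*`-polynomials: elements of the free (non-unital) `*`-algebra over `ℚ(i)` on the
indeterminates `x₀, x₁, …`, written as finite sums of terms. The term `(a, b, l, w)` has the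
coefficient `ratOfCode a + ratOfCode b * i`, and its monomial is the nonempty word with first letter
`l` and remaining letters `w`; the letter `2 n` is `xₙ` and the letter `2 n + 1` is `xₙ*`. -/
abbrev RatStarPoly : Type := List (ℕ × ℕ × ℕ × List ℕ)

/-- The effective enumeration of the rational `*`-polynomials. -/
def ratStarPoly (j : ℕ) : RatStarPoly := Denumerable.ofNat RatStarPoly j

/-- A presentation of a C*-algebra `A`: a sequence that generates a dense `*`-subalgebra. -/
structure CStarPresentation (A : Type u) [NonUnitalCStarAlgebra A] where
  gen : ℕ → A
  dense_adjoin : Dense (NonUnitalStarAlgebra.adjoin ℂ (Set.range gen) : Set A)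

namespace CStarPresentation

variable {A : Type u} [NonUnitalCStarAlgebra A]

/-- The value of a letter: `gen n` for `2 n` and `(gen n)*` for `2 n + 1`. -/
def evalLetter (P : CStarPresentation A) (l : ℕ) : A :=
  if l % 2 = 0 then P.gen (l / 2) else star (P.gen (l / 2))

/-- The product of the letters of the nonempty word with first letter `l` and rest `w`. -/
def evalWord (P : CStarPresentation A) (l : ℕ) (w : List ℕ) : A :=
  w.foldl (fun x m => x * P.evalLetter m) (P.evalLetter l)

/-- Substitution of `gen n` for `xₙ` in a rational `*`-polynomial. -/
noncomputable def evalPoly (P : CStarPresentation A) (q : RatStarPoly) : A :=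
  (q.map fun t => ((ratOfCode t.1 : ℂ) + (ratOfCode t.2.1 : ℂ) * Complex.I) •
    P.evalWord t.2.2.1 t.2.2.2).sum

/-- The `j`-th rational vector of a presentation. -/
noncomputable def ratVec (P : CStarPresentation A) (j : ℕ) : A := P.evalPoly (ratStarPoly j)

/-- The diagram of a presentation. -/
def diagram (P : CStarPresentation A) : Set (ℚ × ℕ × ℚ) :=
  {t | 0 < t.1 ∧ 0 < t.2.2 ∧ (t.1 : ℝ) < ‖P.ratVec t.2.1‖ ∧ ‖P.ratVec t.2.1‖ < (t.2.2 : ℝ)}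

/-- The triple `(r, j, r')` with code `n = ⟨r, ⟨j, r'⟩⟩`. -/
def tripleOfCode (n : ℕ) : ℚ × ℕ × ℚ :=
  (ratOfCode n.unpair.1, n.unpair.2.unpair.1, ratOfCode n.unpair.2.unpair.2)

/-- `f` is a name of the presentation: it enumerates (codes of) the elements of the diagram. -/
def IsName (P : CStarPresentation A) (f : ℕ → ℕ) : Prop :=
  P.diagram = {t | ∃ k, tripleOfCode (f k) = t}

/-- `g` is a name of the vector `v` with respect to the presentation: `g k` is an index of a rational
vector at distance less than `2⁻ᵏ` from `v`. -/
def IsVectorName (P : CStarPresentation A) (v : A) (g : ℕ → ℕ) : Prop :=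
  ∀ k, ‖P.ratVec (g k) - v‖ < (2 : ℝ)⁻¹ ^ k

end CStarPresentation

/-! ### Presentations of Polish spaces -/

/-- A presentation of a topological space `X`: a compatible complete metric and a dense sequence. -/
structure SpacePresentation (X : Type u) [τ : TopologicalSpace X] where
  metric : MetricSpace X
  compatible : metric.toPseudoMetricSpace.toUniformSpace.toTopologicalSpace = τ
  complete : @CompleteSpace X metric.toPseudoMetricSpace.toUniformSpace
  point : ℕ → X
  dense_point : DenseRange point

namespace SpacePresentation

variable {X : Type u} [TopologicalSpace X]

/-- The distance function of the presentation. -/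
def d (Q : SpacePresentation X) (x y : X) : ℝ := Q.metric.dist x y

/-- The diagram of a presentation. -/
def diagram (Q : SpacePresentation X) : Set (ℚ × ℕ × ℕ × ℚ) :=
  {t | (t.1 : ℝ) < Q.d (Q.point t.2.1) (Q.point t.2.2.1) ∧
    Q.d (Q.point t.2.1) (Q.point t.2.2.1) < (t.2.2.2 : ℝ)}

/-- The quadruple `(r, j, k, r')` with code `n = ⟨r, ⟨j, ⟨k, r'⟩⟩⟩`. -/
def quadrupleOfCode (n : ℕ) : ℚ × ℕ × ℕ × ℚ :=
  (ratOfCode n.unpair.1, n.unpair.2.unpair.1, n.unpair.2.unpair.2.unpair.1,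
    ratOfCode n.unpair.2.unpair.2.unpair.2)

/-- `h` is a name of the presentation: it enumerates (codes of) the elements of the diagram. -/
def IsName (Q : SpacePresentation X) (h : ℕ → ℕ) : Prop :=
  Q.diagram = {t | ∃ k, quadrupleOfCode (h k) = t}

/-- The finite set of natural numbers with code `n`, through the standard coding of lists. -/
def finsetOfCode (n : ℕ) : Finset ℕ := (Denumerable.ofNat (List ℕ) n).toFinset

/-- `b` is a total boundedness function: `b j` is a code of a finite set `F` such that the open balls
of radius `2⁻ʲ` around the points with index in `F` cover the space. -/
def IsTotalBoundednessFunction (Q : SpacePresentation X) (b : ℕ → ℕ) : Prop :=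
  ∀ j, ∀ x : X, ∃ k ∈ finsetOfCode (b j), Q.d x (Q.point k) < (2 : ℝ)⁻¹ ^ j

end SpacePresentation

/-! A character is determined by its values at the generators, so their real and imaginary parts
embed the compact space Δ(A) into a countable product of lines (`isEmbedding_coord`). The metric is
pulled back from there. It remains to compute distances between suitable points, and finite covers.

The Gelfand transform is isometric, so the set of φ with r < |φ(p)| is nonempty exactly when r <
‖p‖, and a name of the algebra enumerates these facts. Each entry (r, p, r') yields a point. The
search finds t with ‖t‖ < 1, r < ‖pt‖ and ‖(uₙ - z)pt‖ < 2⁻ᵐ r, and replaces p by pt. The closed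
sets r ≤ |φ(p)| shrink, stay nonempty, and on the new one φ(uₙ) is within 2⁻ᵐ of z. All pairs (n, m)
are treated, so a point in the intersection has computable coordinates. Urysohn functions show that
these points are dense (`denseRange_point`), and `exists_localizing_multiple` shows that the
searches succeed.

For covers, take polynomials q₁, …, q_L and a rational vector v within 1/2 of the unit. If |φ(q_l)|
≤ 1/2 for all l, then |φ(v ∏(1 - q_l))| ≥ 2^-(L+1). Hence the bound ‖v ∏(1 - q_l)‖ < 2^-(L+1), which
the name can confirm, certifies that the sets 1/2 < |φ(q_l)| cover Δ(A) (`CoverCheck.exists_near`).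
Bump elements and compactness provide such certificates with small sets (`exists_cover`).

The name lists only positive lower bounds, so it never mentions a vector of norm zero. Every vector
whose norm is to be bounded above must therefore be kept nonzero. -/

namespace OracleMachine

/-! ### Oracle programs that have to succeed only on a prescribed domain -/

open Encodable

/-- Every primitive recursive function is computed by a program that ignores the oracle. -/
theorem exists_eval_of_primrec {φ : ℕ → ℕ} (h : Nat.Primrec φ) :
    ∃ c : OracleMachine, ∀ O n, c.eval O n = Part.some (φ n) := by
  induction h with
  | zero => exact ⟨zero, fun _ _ => rfl⟩
  | succ => exact ⟨succ, fun _ _ => rfl⟩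
  | left => exact ⟨left, fun _ _ => rfl⟩
  | right => exact ⟨right, fun _ _ => rfl⟩
  | pair _ _ h₁ h₂ =>
    obtain ⟨c, hc⟩ := h₁
    obtain ⟨e, he⟩ := h₂
    exact ⟨pair c e, fun O n => by simp [eval, hc, he, Seq.seq]⟩
  | comp _ _ h₁ h₂ =>
    obtain ⟨c, hc⟩ := h₁
    obtain ⟨e, he⟩ := h₂
    exact ⟨comp c e, fun O n => Part.eq_some_iff.2
      (Part.mem_bind (by rw [he]; exact Part.mem_some _) (by rw [hc]; exact Part.mem_some _))⟩
  | prec _ _ h₁ h₂ =>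
    obtain ⟨c, hc⟩ := h₁
    obtain ⟨e, he⟩ := h₂
    refine ⟨prec c e, fun O n => ?_⟩
    simp only [eval, hc, he, Nat.unpaired]
    induction n.unpair.2 with
    | zero => rfl
    | succ y ih => exact Part.eq_some_iff.2 (Part.mem_bind (Part.eq_some_iff.1 ih) (Part.mem_some _))

variable {α β γ σ : Type} [Primcodable α] [Primcodable β] [Primcodable γ] [Primcodable σ]

/-- A single program computes, up to encodings, `Φ O a` from `a` with the oracle `O`, for all pairs
`(O, a)` in the domain `D`. -/
def ComputableOn (D : (ℕ → ℕ) → α → Prop) (Φ : (ℕ → ℕ) → α → β) : Prop :=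
  ∃ c : OracleMachine, ∀ O a, D O a → encode (Φ O a) ∈ c.eval O (encode a)

namespace ComputableOn

theorem of_primrec {D : (ℕ → ℕ) → α → Prop} {φ : α → β} (h : Primrec φ) :
    ComputableOn D fun _ => φ := by
  -- `Primrec` encodes the result as an `Option`, which shifts its code by one; the predecessor
  -- removes the shift.
  obtain ⟨c, hc⟩ := exists_eval_of_primrec (Nat.Primrec.pred.comp h)
  exact ⟨c, fun O a _ => by simp [hc]⟩

theorem oracle {D : (ℕ → ℕ) → ℕ → Prop} : ComputableOn D fun O n => O n :=
  ⟨.oracle, fun O n _ => by simp [eval]⟩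

theorem mono {D D' : (ℕ → ℕ) → α → Prop} {Φ : (ℕ → ℕ) → α → β} (h : ComputableOn D Φ)
    (hD : ∀ O a, D' O a → D O a) : ComputableOn D' Φ := by
  obtain ⟨c, hc⟩ := h
  exact ⟨c, fun O a h => hc O a (hD O a h)⟩

theorem comp {D : (ℕ → ℕ) → α → Prop} {E : (ℕ → ℕ) → β → Prop} {Ψ : (ℕ → ℕ) → β → γ}
    {Φ : (ℕ → ℕ) → α → β} (hΨ : ComputableOn E Ψ) (hΦ : ComputableOn D Φ)
    (hDE : ∀ O a, D O a → E O (Φ O a)) : ComputableOn D fun O a => Ψ O (Φ O a) := by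
  obtain ⟨c, hc⟩ := hΨ
  obtain ⟨e, he⟩ := hΦ
  exact ⟨.comp c e, fun O a h => Part.mem_bind (he O a h) (hc O _ (hDE O a h))⟩

theorem primrec_comp {D : (ℕ → ℕ) → α → Prop} {φ : β → γ} {Φ : (ℕ → ℕ) → α → β}
    (hφ : Primrec φ) (hΦ : ComputableOn D Φ) : ComputableOn D fun O a => φ (Φ O a) :=
  (of_primrec (D := fun _ _ => True) hφ).comp hΦ fun _ _ _ => trivial

theorem pair {D : (ℕ → ℕ) → α → Prop} {Φ : (ℕ → ℕ) → α → β} {Ψ : (ℕ → ℕ) → α → γ}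
    (hΦ : ComputableOn D Φ) (hΨ : ComputableOn D Ψ) :
    ComputableOn D fun O a => (Φ O a, Ψ O a) := by
  obtain ⟨c, hc⟩ := hΦ
  obtain ⟨e, he⟩ := hΨ
  refine ⟨.pair c e, fun O a h => ?_⟩
  have h1 := Part.eq_some_iff.2 (hc O a h)
  have h2 := Part.eq_some_iff.2 (he O a h)
  simp [eval, h1, h2, Seq.seq]

/-- Unbounded search for a zero. -/
theorem search {D : (ℕ → ℕ) → α → Prop} {t : (ℕ → ℕ) → α × ℕ → ℕ}
    (ht : ComputableOn (fun O (x : α × ℕ) => D O x.1) t) (hD : ∀ O a, D O a → ∃ y, t O (a, y) = 0) :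
    ComputableOn D fun O a => sInf {y | t O (a, y) = 0} := by
  obtain ⟨c, hc⟩ := ht
  refine ⟨.rfind c, fun O a h => ?_⟩
  have hc' : ∀ y, c.eval O (Nat.pair (encode a) y) = Part.some (t O (a, y)) := fun y => by
    simpa using Part.eq_some_iff.2 (hc O (a, y) h)
  simp only [eval, encode_nat]
  refine Nat.mem_rfind.2 ⟨?_, fun {m} hm => ?_⟩
  · have : t O (a, sInf {y | t O (a, y) = 0}) = 0 := Nat.sInf_mem (hD O a h)
    simpa [hc'] using this
  · simpa [hc', eq_comm] using Nat.notMem_of_lt_sInf hm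

/-- Iteration of a step that is computable on an invariant set of states. -/
theorem iterate {D : (ℕ → ℕ) → α → Prop} {E : (ℕ → ℕ) → σ → Prop} {init : (ℕ → ℕ) → α → σ}
    {step : (ℕ → ℕ) → σ → σ} (hi : ComputableOn D init) (hs : ComputableOn E step)
    (h0 : ∀ O a, D O a → E O (init O a)) (h1 : ∀ O s, E O s → E O (step O s)) :
    ComputableOn (fun O (x : α × ℕ) => D O x.1) fun O x => (step O)^[x.2] (init O x.1) := by
  obtain ⟨c, hc⟩ := hi
  obtain ⟨e, he⟩ := hs
  -- The recursion hands over ⟨a, ⟨y, state⟩⟩; two right projections extract the state.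
  refine ⟨.prec c (.comp e (.comp .right .right)), fun O x h => ?_⟩
  obtain ⟨a, n⟩ := x
  have hE : ∀ n, E O ((step O)^[n] (init O a)) := fun n => by
    induction n with
    | zero => exact h0 O a h
    | succ n ih => rw [Function.iterate_succ_apply']; exact h1 O _ ih
  simp only [eval, encode_prod_val, Nat.unpair_pair, encode_nat]
  induction n with
  | zero => exact hc O a h
  | succ n ih =>
    rw [Function.iterate_succ_apply']
    refine Part.mem_bind (ih h) ?_
    refine Part.mem_bind (Part.mem_bind (Part.mem_some _) (Part.mem_some _)) ?_
    simpa using he O _ (hE n)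

end ComputableOn

/-- The list of the first `n` values of a function. -/
def initialSegment (f : ℕ → ℕ) (n : ℕ) : List ℕ := (List.range n).map f

theorem mem_initialSegment {f : ℕ → ℕ} {n x : ℕ} :
    x ∈ initialSegment f n ↔ ∃ k < n, f k = x := by
  simp [initialSegment]

theorem length_initialSegment (f : ℕ → ℕ) (n : ℕ) : (initialSegment f n).length = n := by
  simp [initialSegment]

theorem getD_initialSegment {f : ℕ → ℕ} {n k : ℕ} (h : k < n) (d : ℕ) :
    (initialSegment f n).getD k d = f k := by
  simp [initialSegment, h]

/-- The even half of the oracle is `f` in `bairePair f g`. Reading a finite prefix of it turns every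
test against the name into a primitive recursive test on a list. -/
theorem computableOn_initialSegment {D : (ℕ → ℕ) → ℕ → Prop} :
    ComputableOn D fun O n => initialSegment (fun i => O (2 * i)) n := by
  have hs : ComputableOn (fun _ _ => True)
      fun (O : ℕ → ℕ) (l : List ℕ) => l ++ [O (2 * l.length)] :=
    .primrec_comp (φ := fun x : List ℕ × ℕ => x.1 ++ [x.2])
      (Primrec.list_concat.comp .fst .snd)
      (.pair (.of_primrec .id) (ComputableOn.oracle.comp (D := fun _ _ => True)
        (E := fun _ _ => True)
        (.of_primrec (Primrec.nat_mul.comp (.const 2) .list_length)) fun _ _ _ => trivial))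
  have := ComputableOn.comp (D := D)
    (.iterate (D := fun _ _ => True) (init := fun _ (_ : ℕ) => ([] : List ℕ))
      (.of_primrec (.const _)) hs (fun _ _ _ => trivial) fun _ _ _ => trivial)
    (.of_primrec (Primrec.pair (.const 0) .id)) fun _ _ _ => trivial
  refine cast (congrArg (ComputableOn D) (funext fun O => funext fun n => ?_)) this
  simp only [id]
  induction n with
  | zero => rfl
  | succ n ih =>
    rw [Function.iterate_succ_apply', ih, length_initialSegment]
    simp [initialSegment, List.range_succ]

end OracleMachine

/-! ### Arithmetic on codes of rational numbers -/

namespace RatCode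

/-- The code `⟨n, ⟨0, 0⟩⟩` of a natural number. -/
def ofNat (n : ℕ) : ℕ := Nat.pair n (Nat.pair 0 0)

/-- A code of `2⁻ⁿ`. -/
def invPow (n : ℕ) : ℕ := Nat.pair 1 (Nat.pair 0 (2 ^ n - 1))

def neg (x : ℕ) : ℕ :=
  Nat.pair x.unpair.2.unpair.1 (Nat.pair x.unpair.1 x.unpair.2.unpair.2)

def abs (x : ℕ) : ℕ :=
  Nat.pair (max x.unpair.1 x.unpair.2.unpair.1)
    (Nat.pair (min x.unpair.1 x.unpair.2.unpair.1) x.unpair.2.unpair.2)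

/-- A code stores the denominator minus one, hence the shift in the last component. -/
def add (x y : ℕ) : ℕ :=
  Nat.pair (x.unpair.1 * (y.unpair.2.unpair.2 + 1) + y.unpair.1 * (x.unpair.2.unpair.2 + 1))
    (Nat.pair
      (x.unpair.2.unpair.1 * (y.unpair.2.unpair.2 + 1) +
        y.unpair.2.unpair.1 * (x.unpair.2.unpair.2 + 1))
      ((x.unpair.2.unpair.2 + 1) * (y.unpair.2.unpair.2 + 1) - 1))

def mul (x y : ℕ) : ℕ :=
  Nat.pair (x.unpair.1 * y.unpair.1 + x.unpair.2.unpair.1 * y.unpair.2.unpair.1)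
    (Nat.pair
      (x.unpair.1 * y.unpair.2.unpair.1 + x.unpair.2.unpair.1 * y.unpair.1)
      ((x.unpair.2.unpair.2 + 1) * (y.unpair.2.unpair.2 + 1) - 1))

/-- Comparison of the rational numbers with given codes. -/
def Le (x y : ℕ) : Prop :=
  x.unpair.1 * (y.unpair.2.unpair.2 + 1) + y.unpair.2.unpair.1 * (x.unpair.2.unpair.2 + 1) ≤
    y.unpair.1 * (x.unpair.2.unpair.2 + 1) + x.unpair.2.unpair.1 * (y.unpair.2.unpair.2 + 1)

instance : DecidableRel Le := fun _ _ => Nat.decLe _ _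

def min (x y : ℕ) : ℕ := if Le x y then x else y

theorem ratOfCode_ofNat (n : ℕ) : ratOfCode (ofNat n) = n := by simp [ratOfCode, ofNat]

theorem ratOfCode_zero : ratOfCode 0 = 0 := by simp [ratOfCode]

theorem ratOfCode_invPow (n : ℕ) : ratOfCode (invPow n) = 2⁻¹ ^ n := by
  simp [ratOfCode, invPow]

theorem ratOfCode_neg (x : ℕ) : ratOfCode (neg x) = -ratOfCode x := by
  simp only [ratOfCode, neg, Nat.unpair_pair]
  ring

theorem ratOfCode_abs (x : ℕ) : ratOfCode (abs x) = |ratOfCode x| := by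
  have h : (0 : ℚ) < (x.unpair.2.unpair.2 : ℚ) + 1 := by positivity
  simp only [ratOfCode, abs, Nat.unpair_pair, abs_div, abs_of_pos h, Nat.cast_max, Nat.cast_min,
    max_sub_min_eq_abs']

theorem ratOfCode_add (x y : ℕ) : ratOfCode (add x y) = ratOfCode x + ratOfCode y := by
  have h : ((x.unpair.2.unpair.2 : ℚ) + 1) ≠ 0 := by positivity
  have h' : ((y.unpair.2.unpair.2 : ℚ) + 1) ≠ 0 := by positivity
  have e : 1 ≤ (x.unpair.2.unpair.2 + 1) * (y.unpair.2.unpair.2 + 1) :=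
    Nat.mul_pos (Nat.succ_pos _) (Nat.succ_pos _)
  simp only [ratOfCode, add, Nat.unpair_pair]
  push_cast [Nat.cast_sub e]
  field_simp
  ring

theorem ratOfCode_mul (x y : ℕ) : ratOfCode (mul x y) = ratOfCode x * ratOfCode y := by
  have h : ((x.unpair.2.unpair.2 : ℚ) + 1) ≠ 0 := by positivity
  have h' : ((y.unpair.2.unpair.2 : ℚ) + 1) ≠ 0 := by positivity
  have e : 1 ≤ (x.unpair.2.unpair.2 + 1) * (y.unpair.2.unpair.2 + 1) :=
    Nat.mul_pos (Nat.succ_pos _) (Nat.succ_pos _)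
  simp only [ratOfCode, mul, Nat.unpair_pair]
  push_cast [Nat.cast_sub e]
  field_simp
  ring

theorem le_iff (x y : ℕ) : Le x y ↔ ratOfCode x ≤ ratOfCode y := by
  have h : (0 : ℚ) < (x.unpair.2.unpair.2 : ℚ) + 1 := by positivity
  have h' : (0 : ℚ) < (y.unpair.2.unpair.2 : ℚ) + 1 := by positivity
  rw [ratOfCode, ratOfCode, div_le_div_iff₀ h h', Le, ← Nat.cast_le (α := ℚ)]
  push_cast
  constructor <;> intro h <;> linarith

theorem ratOfCode_min (x y : ℕ) :
    ratOfCode (min x y) = Min.min (ratOfCode x) (ratOfCode y) := by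
  rw [min, min_def, apply_ite ratOfCode]
  simp only [le_iff]

theorem ratOfCode_surjective : Function.Surjective ratOfCode := fun q => by
  refine ⟨Nat.pair q.num.toNat (Nat.pair (-q.num).toNat (q.den - 1)), ?_⟩
  have h1 : ((q.num.toNat : ℚ) - ((-q.num).toNat : ℚ)) = q.num := by
    exact_mod_cast Int.toNat_sub_toNat_neg q.num
  have h2 : ((q.den - 1 : ℕ) : ℚ) + 1 = q.den := by
    exact_mod_cast Nat.sub_add_cancel q.den_pos
  simp only [ratOfCode, Nat.unpair_pair, h1, h2]
  exact Rat.num_div_den q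

section Primrec

open _root_.Primrec

variable {α : Type*} [Primcodable α] {f g : α → ℕ}

theorem primrec_numPos (hf : Primrec f) : Primrec fun a => (f a).unpair.1 :=
  fst.comp (unpair.comp hf)

theorem primrec_numNeg (hf : Primrec f) : Primrec fun a => (f a).unpair.2.unpair.1 :=
  fst.comp (unpair.comp (snd.comp (unpair.comp hf)))

theorem primrec_denPred (hf : Primrec f) : Primrec fun a => (f a).unpair.2.unpair.2 :=
  snd.comp (unpair.comp (snd.comp (unpair.comp hf)))

theorem primrec_natPair (hf : Primrec f) (hg : Primrec g) :
    Primrec fun a => Nat.pair (f a) (g a) :=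
  Primrec₂.natPair.comp hf hg

theorem primrec_mulSucc (hf : Primrec f) (hg : Primrec g) :
    Primrec fun a => f a * (g a + 1) :=
  nat_mul.comp hf (succ.comp hg)

theorem primrec_pow (hf : Primrec f) : Primrec fun a => 2 ^ f a :=
  Primrec₂.comp (Primrec₂.unpaired'.1 Nat.Primrec.pow) (const 2) hf

theorem primrec_ofNat (hf : Primrec f) : Primrec fun a => ofNat (f a) :=
  primrec_natPair hf (const _)

theorem primrec_invPow (hf : Primrec f) : Primrec fun a => invPow (f a) :=
  primrec_natPair (const _) (primrec_natPair (const _) (nat_sub.comp (primrec_pow hf) (const _)))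

theorem primrec_neg (hf : Primrec f) : Primrec fun a => neg (f a) :=
  primrec_natPair (primrec_numNeg hf) (primrec_natPair (primrec_numPos hf) (primrec_denPred hf))

theorem primrec_abs (hf : Primrec f) : Primrec fun a => abs (f a) :=
  primrec_natPair (nat_max.comp (primrec_numPos hf) (primrec_numNeg hf))
    (primrec_natPair (nat_min.comp (primrec_numPos hf) (primrec_numNeg hf)) (primrec_denPred hf))

theorem primrec_den (hf : Primrec f) (hg : Primrec g) : Primrec fun a =>
    ((f a).unpair.2.unpair.2 + 1) * ((g a).unpair.2.unpair.2 + 1) - 1 :=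
  nat_sub.comp (primrec_mulSucc (succ.comp (primrec_denPred hf)) (primrec_denPred hg)) (const 1)

theorem primrec_add (hf : Primrec f) (hg : Primrec g) : Primrec fun a => add (f a) (g a) :=
  primrec_natPair
    (nat_add.comp (primrec_mulSucc (primrec_numPos hf) (primrec_denPred hg))
      (primrec_mulSucc (primrec_numPos hg) (primrec_denPred hf)))
    (primrec_natPair
      (nat_add.comp (primrec_mulSucc (primrec_numNeg hf) (primrec_denPred hg))
        (primrec_mulSucc (primrec_numNeg hg) (primrec_denPred hf)))
      (primrec_den hf hg))

theorem primrec_mul (hf : Primrec f) (hg : Primrec g) : Primrec fun a => mul (f a) (g a) :=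
  primrec_natPair
    (nat_add.comp (nat_mul.comp (primrec_numPos hf) (primrec_numPos hg))
      (nat_mul.comp (primrec_numNeg hf) (primrec_numNeg hg)))
    (primrec_natPair
      (nat_add.comp (nat_mul.comp (primrec_numPos hf) (primrec_numNeg hg))
        (nat_mul.comp (primrec_numNeg hf) (primrec_numPos hg)))
      (primrec_den hf hg))

theorem primrec_le (hf : Primrec f) (hg : Primrec g) : PrimrecPred fun a => Le (f a) (g a) :=
  nat_le.comp
    (nat_add.comp (primrec_mulSucc (primrec_numPos hf) (primrec_denPred hg))
      (primrec_mulSucc (primrec_numNeg hg) (primrec_denPred hf)))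
    (nat_add.comp (primrec_mulSucc (primrec_numPos hg) (primrec_denPred hf))
      (primrec_mulSucc (primrec_numNeg hf) (primrec_denPred hg)))

theorem primrec_min (hf : Primrec f) (hg : Primrec g) : Primrec fun a => min (f a) (g a) :=
  ite (primrec_le hf hg) hf hg

end Primrec

end RatCode

/-! ### Arithmetic on rational `*`-polynomials -/

namespace RatStarPoly

/-- The product of the rational `*`-polynomial `p` with a coefficient and a possibly empty word. -/
def termMul (a b : ℕ) (u : List ℕ) (p : RatStarPoly) : RatStarPoly :=
  p.map fun t =>
    (RatCode.add (RatCode.mul a t.1) (RatCode.neg (RatCode.mul b t.2.1)),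
      RatCode.add (RatCode.mul a t.2.1) (RatCode.mul b t.1),
      -- The concatenated word is split again into first letter and rest. It is never empty, so the
      -- default value of `headI` does not occur.
      (u ++ t.2.2.1 :: t.2.2.2).headI, (u ++ t.2.2.1 :: t.2.2.2).tail)

def mul (p q : RatStarPoly) : RatStarPoly :=
  p.flatMap fun t => termMul t.1 t.2.1 (t.2.2.1 :: t.2.2.2) q

def sub (p q : RatStarPoly) : RatStarPoly :=
  p ++ termMul (RatCode.neg (RatCode.ofNat 1)) 0 [] q

/-- The product `(xₙ - z) p`, where the complex number `z` is given by codes of its parts. -/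
def genSubMul (n : ℕ) (z : ℕ × ℕ) (p : RatStarPoly) : RatStarPoly :=
  termMul (RatCode.ofNat 1) 0 [2 * n] p ++ termMul (RatCode.neg z.1) (RatCode.neg z.2) [] p

section Primrec

open _root_.Primrec

variable {α : Type*} [Primcodable α]

theorem primrec_termMul {a b : α → ℕ} {u : α → List ℕ} {p : α → RatStarPoly} (ha : Primrec a)
    (hb : Primrec b) (hu : Primrec u) (hp : Primrec p) :
    Primrec fun x => termMul (a x) (b x) (u x) (p x) := by
  have ht : Primrec fun y : α × (ℕ × ℕ × ℕ × List ℕ) => y.2 := snd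
  have h1 := fst.comp ht
  have h2 := fst.comp (snd.comp ht)
  have hw : Primrec fun y : α × (ℕ × ℕ × ℕ × List ℕ) => u y.1 ++ y.2.2.2.1 :: y.2.2.2.2 :=
    list_append.comp (hu.comp fst)
      (list_cons.comp (fst.comp (snd.comp (snd.comp ht))) (snd.comp (snd.comp (snd.comp ht))))
  exact list_map hp <| Primrec₂.mk <|
    .pair (RatCode.primrec_add (RatCode.primrec_mul (ha.comp fst) h1)
        (RatCode.primrec_neg (RatCode.primrec_mul (hb.comp fst) h2)))
      (.pair (RatCode.primrec_add (RatCode.primrec_mul (ha.comp fst) h2)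
        (RatCode.primrec_mul (hb.comp fst) h1)) (.pair (list_headI.comp hw) (list_tail.comp hw)))

theorem primrec_mul {p q : α → RatStarPoly} (hp : Primrec p) (hq : Primrec q) :
    Primrec fun x => mul (p x) (q x) :=
  list_flatMap hp <| Primrec₂.mk <| primrec_termMul (fst.comp snd) (fst.comp (snd.comp snd))
    (list_cons.comp (fst.comp (snd.comp (snd.comp snd))) (snd.comp (snd.comp (snd.comp snd))))
    (hq.comp fst)

theorem primrec_sub {p q : α → RatStarPoly} (hp : Primrec p) (hq : Primrec q) :
    Primrec fun x => sub (p x) (q x) :=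
  list_append.comp hp (primrec_termMul (const _) (const _) (const _) hq)

theorem primrec_genSubMul {n : α → ℕ} {z : α → ℕ × ℕ} {p : α → RatStarPoly} (hn : Primrec n)
    (hz : Primrec z) (hp : Primrec p) : Primrec fun x => genSubMul (n x) (z x) (p x) :=
  list_append.comp
    (primrec_termMul (const _) (const _)
      (list_cons.comp (nat_mul.comp (const 2) hn) (const [])) hp)
    (primrec_termMul (RatCode.primrec_neg (fst.comp hz)) (RatCode.primrec_neg (snd.comp hz))
      (const []) hp)

theorem primrec_ratStarPoly {f : α → ℕ} (hf : Primrec f) : Primrec fun x => ratStarPoly (f x) := by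
  have h : Primrec fun n : ℕ => ((Encodable.decode n : Option RatStarPoly)).getD [] :=
    option_getD.comp Primrec.decode (const [])
  refine (h.of_eq fun n => ?_).comp hf
  simp [ratStarPoly]

end Primrec

end RatStarPoly

/-! ### Evaluation of rational polynomials and density of their values -/

/-- The complex number with real and imaginary part of given codes. -/
noncomputable def complexOfCode (z : ℕ × ℕ) : ℂ :=
  (ratOfCode z.1 : ℂ) + (ratOfCode z.2 : ℂ) * Complex.I

namespace CStarPresentation

open RatStarPoly

variable {A : Type u} [CommCStarAlgebra A] (P : CStarPresentation A)

theorem evalWord_eq_prod (l : ℕ) (w : List ℕ) :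
    P.evalWord l w = ((l :: w).map P.evalLetter).prod := by
  have h (x : A) : w.foldl (fun x m => x * P.evalLetter m) x = x * (w.map P.evalLetter).prod := by
    induction w generalizing x with
    | nil => simp
    | cons a w ih => rw [List.foldl_cons, ih]; simp [mul_assoc]
  rw [evalWord, h]
  simp

theorem evalPoly_nil : P.evalPoly [] = 0 := rfl

theorem evalPoly_cons (t : ℕ × ℕ × ℕ × List ℕ) (p : RatStarPoly) :
    P.evalPoly (t :: p) =
      complexOfCode (t.1, t.2.1) • ((t.2.2.1 :: t.2.2.2).map P.evalLetter).prod + P.evalPoly p := by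
  rw [← evalWord_eq_prod]
  simp [evalPoly, complexOfCode]

theorem evalPoly_append (p q : RatStarPoly) :
    P.evalPoly (p ++ q) = P.evalPoly p + P.evalPoly q := by
  simp [evalPoly]

theorem evalPoly_termMul (a b : ℕ) (u : List ℕ) (p : RatStarPoly) :
    P.evalPoly (termMul a b u p) =
      complexOfCode (a, b) • ((u.map P.evalLetter).prod * P.evalPoly p) := by
  induction p with
  | nil => simp [termMul, evalPoly_nil]
  | cons t p ih =>
    have hw : (u ++ t.2.2.1 :: t.2.2.2).headI :: (u ++ t.2.2.1 :: t.2.2.2).tail =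
        u ++ t.2.2.1 :: t.2.2.2 := by
      cases u <;> rfl
    have hc : complexOfCode (RatCode.add (RatCode.mul a t.1) (RatCode.neg (RatCode.mul b t.2.1)),
        RatCode.add (RatCode.mul a t.2.1) (RatCode.mul b t.1)) =
        complexOfCode (a, b) * complexOfCode (t.1, t.2.1) := by
      simp only [complexOfCode, RatCode.ratOfCode_add, RatCode.ratOfCode_mul,
        RatCode.ratOfCode_neg]
      push_cast
      linear_combination (-(ratOfCode b : ℂ) * ratOfCode t.2.1) * Complex.I_sq
    rw [show termMul a b u (t :: p) = _ :: termMul a b u p from rfl, evalPoly_cons, evalPoly_cons,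
      ih, hw, hc, mul_add, smul_add, List.map_append, List.prod_append, mul_smul_comm, smul_smul]

theorem evalPoly_mul (p q : RatStarPoly) :
    P.evalPoly (mul p q) = P.evalPoly p * P.evalPoly q := by
  induction p with
  | nil => simp [mul, evalPoly_nil]
  | cons t p ih =>
    rw [show mul (t :: p) q = termMul t.1 t.2.1 (t.2.2.1 :: t.2.2.2) q ++ mul p q from rfl,
      evalPoly_append, ih, evalPoly_termMul, evalPoly_cons, add_mul, smul_mul_assoc]

theorem evalPoly_sub (p q : RatStarPoly) :
    P.evalPoly (sub p q) = P.evalPoly p - P.evalPoly q := by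
  simp [sub, evalPoly_append, evalPoly_termMul, complexOfCode, RatCode.ratOfCode_neg,
    RatCode.ratOfCode_ofNat, RatCode.ratOfCode_zero, sub_eq_add_neg]

theorem evalPoly_genSubMul (n : ℕ) (z : ℕ × ℕ) (p : RatStarPoly) :
    P.evalPoly (genSubMul n z p) = (P.gen n - algebraMap ℂ A (complexOfCode z)) * P.evalPoly p := by
  have : complexOfCode (RatCode.neg z.1, RatCode.neg z.2) = -complexOfCode z := by
    simp only [complexOfCode, RatCode.ratOfCode_neg]
    push_cast
    ring
  have h1 : complexOfCode (RatCode.ofNat 1, 0) = 1 := by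
    simp [complexOfCode, RatCode.ratOfCode_ofNat, RatCode.ratOfCode_zero]
  rw [genSubMul, evalPoly_append, evalPoly_termMul, evalPoly_termMul, this, h1, neg_smul, sub_mul,
    Algebra.algebraMap_eq_smul_one, smul_mul_assoc]
  simp [evalLetter, sub_eq_add_neg]

theorem ratVec_encode (p : RatStarPoly) : P.ratVec (Encodable.encode p) = P.evalPoly p := by
  simp [ratVec, ratStarPoly]

theorem denseRange_complexOfCode : DenseRange complexOfCode := by
  intro w
  refine Metric.mem_closure_range_iff.2 fun ε hε => ?_
  obtain ⟨q, hq1, hq2⟩ := exists_rat_btwn (show w.re < w.re + ε / 2 by linarith)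
  obtain ⟨q', hq1', hq2'⟩ := exists_rat_btwn (show w.im < w.im + ε / 2 by linarith)
  obtain ⟨a, rfl⟩ := RatCode.ratOfCode_surjective q
  obtain ⟨b, rfl⟩ := RatCode.ratOfCode_surjective q'
  refine ⟨(a, b), ?_⟩
  rw [dist_eq_norm]
  refine (Complex.norm_le_abs_re_add_abs_im _).trans_lt ?_
  simp only [complexOfCode, Complex.sub_re, Complex.sub_im, Complex.add_re, Complex.add_im,
    Complex.mul_re, Complex.mul_im, Complex.ratCast_re, Complex.ratCast_im, Complex.I_re,
    Complex.I_im]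
  have h1 : |w.re - (ratOfCode a : ℝ)| < ε / 2 := abs_lt.2 ⟨by linarith, by linarith⟩
  have h2 : |w.im - (ratOfCode b : ℝ)| < ε / 2 := abs_lt.2 ⟨by linarith, by linarith⟩
  simp only [mul_zero, mul_one, sub_zero, add_zero, zero_add]
  linarith

/-- The rational vectors of a presentation are dense. -/
theorem denseRange_evalPoly : DenseRange P.evalPoly := by
  let S : Set A := Set.range P.evalPoly
  -- The closure of the rational vectors is stable under the algebra operations, because
  -- approximants can be combined; complex scalars are reached as limits of codes. It therefore
  -- contains the adjoined algebra.
  have hadd : ∀ x ∈ closure S, ∀ y ∈ closure S, x + y ∈ closure S := fun x hx y hy =>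
    map_mem_closure₂ continuous_add hx hy fun _ ⟨p, hp⟩ _ ⟨q, hq⟩ =>
      ⟨p ++ q, by rw [← hp, ← hq, evalPoly_append]⟩
  have hmul : ∀ x ∈ closure S, ∀ y ∈ closure S, x * y ∈ closure S := fun x hx y hy =>
    map_mem_closure₂ continuous_mul hx hy fun _ ⟨p, hp⟩ _ ⟨q, hq⟩ =>
      ⟨mul p q, by rw [← hp, ← hq, evalPoly_mul]⟩
  have hsmul : ∀ (c : ℂ), ∀ x ∈ closure S, c • x ∈ closure S := fun c x hx =>
    map_mem_closure₂ continuous_smul (denseRange_complexOfCode c) hx fun _ ⟨z, hz⟩ _ ⟨q, hq⟩ =>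
      ⟨termMul z.1 z.2 [] q, by rw [← hz, ← hq, evalPoly_termMul]; simp⟩
  have hletter (l : ℕ) : P.evalLetter l ∈ closure S :=
    subset_closure ⟨[(RatCode.ofNat 1, 0, l, [])], by
      rw [evalPoly_cons]
      simp [evalPoly_nil, complexOfCode, RatCode.ratOfCode_ofNat, RatCode.ratOfCode_zero]⟩
  have hsub : (NonUnitalStarAlgebra.adjoin ℂ (Set.range P.gen) : Set A) ⊆ closure S := by
    intro x hx
    have hx' : x ∈ NonUnitalAlgebra.adjoin ℂ (Set.range P.gen ∪ star (Set.range P.gen)) := by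
      rw [← NonUnitalStarAlgebra.adjoin_toNonUnitalSubalgebra]
      exact hx
    clear hx
    induction hx' using NonUnitalAlgebra.adjoin_induction with
    | mem x hx =>
      rcases hx with ⟨n, rfl⟩ | ⟨n, hn⟩
      · simpa [evalLetter] using hletter (2 * n)
      · have := hletter (2 * n + 1)
        rwa [evalLetter, if_neg (by omega), show (2 * n + 1) / 2 = n by omega, hn, star_star]
          at this
    | add x y _ _ hx hy => exact hadd x hx y hy
    | zero => exact subset_closure ⟨[], P.evalPoly_nil⟩
    | mul x y _ _ hx hy => exact hmul x hx y hy
    | smul c x _ hx => exact hsmul c x hx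
  exact fun x => closure_minimal hsub isClosed_closure (P.dense_adjoin x)

end CStarPresentation

open WeakDual Topology Filter

/-! ### Commutative C*-algebras and their characters -/

section Characters

variable {A : Type u} [CommCStarAlgebra A]

theorem norm_character_apply_le (φ : characterSpace ℂ A) (a : A) : ‖φ a‖ ≤ ‖a‖ := by
  have h : ‖gelfandTransform ℂ A a‖ = ‖a‖ := (gelfandTransform_isometry A).norm_map_of_map_zero
    (map_zero _) a
  rw [← h]
  exact (gelfandTransform ℂ A a).norm_coe_le_norm φ

theorem norm_le_of_forall_character {a : A} {C : ℝ} (hC : 0 ≤ C)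
    (h : ∀ φ : characterSpace ℂ A, ‖φ a‖ ≤ C) : ‖a‖ ≤ C := by
  have h' : ‖gelfandTransform ℂ A a‖ = ‖a‖ := (gelfandTransform_isometry A).norm_map_of_map_zero
    (map_zero _) a
  rw [← h']
  exact (ContinuousMap.norm_le _ hC).2 h

theorem continuous_character_apply (a : A) : Continuous fun φ : characterSpace ℂ A => φ a :=
  (gelfandTransform ℂ A a).continuous

/-- Compactness of the spectrum. This turns a lower bound on a norm into nonemptiness of a set of
characters. -/
theorem exists_norm_character_apply_eq [Nontrivial A] (a : A) :
    ∃ φ : characterSpace ℂ A, ‖φ a‖ = ‖a‖ := by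
  obtain ⟨φ, -, hφ⟩ := isCompact_univ.exists_isMaxOn Set.univ_nonempty
    (continuous_character_apply a).norm.continuousOn
  exact ⟨φ, (norm_character_apply_le φ a).antisymm
    (norm_le_of_forall_character (norm_nonneg _) fun ψ => hφ (Set.mem_univ ψ))⟩

/-- Surjectivity of the Gelfand transform, the source of all bump elements below. -/
theorem exists_forall_character_apply_eq {f : characterSpace ℂ A → ℂ} (hf : Continuous f) :
    ∃ a : A, ∀ φ : characterSpace ℂ A, φ a = f φ := by
  refine ⟨(gelfandStarTransform A).symm ⟨f, hf⟩, fun φ => ?_⟩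
  exact DFunLike.congr_fun ((gelfandStarTransform A).apply_symm_apply ⟨f, hf⟩) φ

theorem character_algebraMap (φ : characterSpace ℂ A) (z : ℂ) : φ (algebraMap ℂ A z) = z :=
  AlgHomClass.commutes φ z

end Characters

/-! ### Bump elements, localization and certificates for covers -/

namespace CStarPresentation

variable {A : Type u} [CommCStarAlgebra A] (P : CStarPresentation A)

/-- Characters preserve `star`, so agreement at the generators extends to all rational vectors,
which are dense. -/
theorem character_ext {φ ψ : characterSpace ℂ A} (h : ∀ n, φ (P.gen n) = ψ (P.gen n)) : φ = ψ := by
  have hl (l : ℕ) : φ (P.evalLetter l) = ψ (P.evalLetter l) := by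
    rw [evalLetter]
    split_ifs
    · exact h _
    · rw [map_star, map_star, h]
  have hp (p : RatStarPoly) : φ (P.evalPoly p) = ψ (P.evalPoly p) := by
    induction p with
    | nil => simp [evalPoly_nil]
    | cons t p ih =>
      rw [evalPoly_cons, map_add, map_add, ih, map_smul, map_smul, map_list_prod, map_list_prod,
        List.map_map, List.map_map]
      congr 4
      exact funext hl
  refine DFunLike.ext _ _ fun a => ?_
  exact congrFun (P.denseRange_evalPoly.equalizer (map_continuous φ) (map_continuous ψ)
    (funext hp)) a

/-- Avoiding `w` itself keeps the products of `gen n - z` with a bump element nonzero. -/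
theorem exists_complexOfCode_near (w : ℂ) {δ : ℝ} (hδ : 0 < δ) :
    ∃ z, complexOfCode z ≠ w ∧ ‖complexOfCode z - w‖ < δ := by
  have ho : IsOpen (Metric.ball w δ ∩ {w}ᶜ) := Metric.isOpen_ball.inter isOpen_compl_singleton
  obtain ⟨z, hz⟩ := denseRange_complexOfCode.exists_mem_open ho
    ⟨w + (δ / 2 : ℝ), by simp [abs_of_pos hδ, hδ], by simp [hδ.ne']⟩
  exact ⟨z, hz.2, by simpa [dist_eq_norm] using hz.1⟩

/-- Bump functions around a character. -/
theorem exists_bump (φ₀ : characterSpace ℂ A) (N : ℕ) {δ : ℝ} (hδ : 0 < δ) :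
    ∃ a : A, (∀ φ : characterSpace ℂ A, ∃ s : ℝ, 0 ≤ s ∧ s ≤ 1 ∧ φ a = s) ∧
      (∀ φ : characterSpace ℂ A, φ a ≠ 0 → ∀ n < N, ‖φ (P.gen n) - φ₀ (P.gen n)‖ < δ) ∧
      ∀ᶠ φ in 𝓝 φ₀, φ a = 1 := by
  let D : characterSpace ℂ A → ℝ := fun φ =>
    ∑ n ∈ Finset.range N, ‖φ (P.gen n) - φ₀ (P.gen n)‖
  have hD : Continuous D := continuous_finsetSum _ fun n _ =>
    ((continuous_character_apply _).sub continuous_const).norm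
  -- The clamped function is 1 where `D ≤ δ / 2` and 0 where `D ≥ δ`.
  obtain ⟨a, ha⟩ := exists_forall_character_apply_eq (A := A)
    (f := fun φ => ((max 0 (min 1 (2 - 2 * D φ / δ)) : ℝ) : ℂ)) (by fun_prop)
  refine ⟨a, fun φ => ⟨_, le_max_left _ _, max_le zero_le_one (min_le_left _ _), ha φ⟩,
    fun φ h n hn => ?_, ?_⟩
  · refine (Finset.single_le_sum (f := fun n => ‖φ (P.gen n) - φ₀ (P.gen n)‖)
      (fun _ _ => norm_nonneg _) (Finset.mem_range.2 hn)).trans_lt ?_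
    by_contra! hc
    refine h ?_
    have : 2 - 2 * D φ / δ ≤ 0 := by
      rw [sub_nonpos, le_div_iff₀ hδ]
      exact mul_le_mul_of_nonneg_left hc zero_le_two
    rw [ha, max_eq_left ((min_le_right _ _).trans this)]
    simp
  · have h0 : D φ₀ < δ / 2 := by simpa [D] using hδ
    filter_upwards [hD.continuousAt.eventually_lt continuousAt_const h0] with φ hφ
    have : 1 ≤ 2 - 2 * D φ / δ := by
      have : 2 * D φ / δ ≤ 1 := by
        rw [div_le_one hδ]
        linarith
      linarith
    rw [ha, min_eq_left this]
    simp

/-- Where `a` does not vanish, both the value of the generator and `z` lie within `δ` of the value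
at `φ₀`, and `a` has values in [0, 1]. -/
theorem norm_gen_sub_mul_le {a : A} {N n : ℕ} (hn : n < N) {φ₀ : characterSpace ℂ A} {δ : ℝ}
    (h0 : ∀ φ : characterSpace ℂ A, ∃ s : ℝ, 0 ≤ s ∧ s ≤ 1 ∧ φ a = s)
    (h1 : ∀ φ : characterSpace ℂ A, φ a ≠ 0 → ∀ n < N, ‖φ (P.gen n) - φ₀ (P.gen n)‖ < δ)
    (hδ : 0 ≤ δ) {z : ℂ} (hz : ‖z - φ₀ (P.gen n)‖ < δ) :
    ‖(P.gen n - algebraMap ℂ A z) * a‖ ≤ 2 * δ := by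
  refine norm_le_of_forall_character (by positivity) fun φ => ?_
  by_cases h : φ a = 0
  · simp [h, hδ]
  obtain ⟨s, hs0, hs1, hs⟩ := h0 φ
  rw [map_mul, map_sub, character_algebraMap, norm_mul]
  have ha : ‖φ a‖ ≤ 1 := by simpa [hs, abs_of_nonneg hs0] using hs1
  have hb : ‖φ (P.gen n) - z‖ ≤ 2 * δ := by
    have := norm_sub_le_norm_sub_add_norm_sub (φ (P.gen n)) (φ₀ (P.gen n)) z
    have h2 := h1 φ h n hn
    rw [norm_sub_rev] at hz
    linarith
  exact (mul_le_of_le_one_right (norm_nonneg _) ha).trans hb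

/-- Every nonempty set of the form `{φ | r < ‖φ p‖}` can be shrunk, by passing to a multiple of `p`,
to one on which the `n`-th generator is almost constant. -/
theorem exists_localizing_multiple [Nontrivial A] {p : A} {r : ℝ} (hr : 0 < r) (hp : r < ‖p‖)
    (n : ℕ) {ε : ℝ} (hε : 0 < ε) :
    ∃ (t : RatStarPoly) (z : ℕ × ℕ), ‖P.evalPoly t‖ < 1 ∧ r < ‖p * P.evalPoly t‖ ∧
      0 < ‖(P.gen n - algebraMap ℂ A (complexOfCode z)) * (p * P.evalPoly t)‖ ∧
      ‖(P.gen n - algebraMap ℂ A (complexOfCode z)) * (p * P.evalPoly t)‖ < ε := by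
  have hp0 : 0 < ‖p‖ := hr.trans hp
  obtain ⟨φ₀, hφ₀⟩ := exists_norm_character_apply_eq p
  -- Scaling the bump by `c` gives norm below 1, while at `φ₀` the product with `p` still exceeds
  -- `r`. All four required inequalities are then strict, so they survive the passage to a rational
  -- vector.
  obtain ⟨c, hc1, hc2⟩ := exists_between ((div_lt_one hp0).2 hp)
  have hc0 : 0 < c := (div_pos hr hp0).trans hc1
  set δ := ε / (4 * ‖p‖) with hδ
  have hδ0 : 0 < δ := by positivity
  obtain ⟨a, ha0, ha1, ha2⟩ := P.exists_bump φ₀ (n + 1) hδ0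
  obtain ⟨z, hz1, hz2⟩ := exists_complexOfCode_near (φ₀ (P.gen n)) hδ0
  have haφ₀ : φ₀ a = 1 := ha2.self_of_nhds
  have hsmall := P.norm_gen_sub_mul_le n.lt_succ_self ha0 ha1 hδ0.le hz2
  have hna : ‖a‖ ≤ 1 := norm_le_of_forall_character zero_le_one fun φ => by
    obtain ⟨s, hs0, hs1, hs⟩ := ha0 φ
    simpa [hs, abs_of_nonneg hs0] using hs1
  set w := P.gen n - algebraMap ℂ A (complexOfCode z) with hw
  have ho : IsOpen {t : A | ‖t‖ < 1 ∧ r < ‖p * t‖ ∧ 0 < ‖w * (p * t)‖ ∧ ‖w * (p * t)‖ < ε} := by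
    simp only [Set.ofPred_and]
    exact (isOpen_lt (by fun_prop) (by fun_prop)).inter
      ((isOpen_lt (by fun_prop) (by fun_prop)).inter
        ((isOpen_lt (by fun_prop) (by fun_prop)).inter (isOpen_lt (by fun_prop) (by fun_prop))))
  suffices h : (c : ℂ) • a ∈ {t : A | ‖t‖ < 1 ∧ r < ‖p * t‖ ∧ 0 < ‖w * (p * t)‖ ∧
      ‖w * (p * t)‖ < ε} by
    obtain ⟨t, ht⟩ := P.denseRange_evalPoly.exists_mem_open ho ⟨_, h⟩
    exact ⟨t, z, ht⟩
  refine ⟨?_, ?_, ?_, ?_⟩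
  · rw [norm_smul, Complex.norm_real, Real.norm_of_nonneg hc0.le]
    exact (mul_le_of_le_one_right hc0.le hna).trans_lt hc2
  · refine lt_of_lt_of_le ?_ (norm_character_apply_le φ₀ _)
    rw [map_mul, map_smul, haφ₀, norm_mul, hφ₀]
    rw [div_lt_iff₀ hp0] at hc1
    simpa [abs_of_pos hc0, mul_comm] using hc1
  · refine lt_of_lt_of_le ?_ (norm_character_apply_le φ₀ _)
    rw [map_mul, map_mul, map_smul, haφ₀, norm_mul, norm_mul, hφ₀, hw, map_sub,
      character_algebraMap]
    have : 0 < ‖φ₀ (P.gen n) - complexOfCode z‖ := norm_pos_iff.2 (sub_ne_zero.2 hz1.symm)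
    have h' : 0 < ‖(c : ℂ) • (1 : ℂ)‖ := by simpa using hc0.ne'
    positivity
  · have e : w * (p * (c : ℂ) • a) = (c : ℂ) • (p * (w * a)) := by
      rw [mul_smul_comm, mul_smul_comm, mul_left_comm]
    rw [e, norm_smul, Complex.norm_real, Real.norm_of_nonneg hc0.le]
    have h1 : ‖p * (w * a)‖ ≤ ‖p‖ * (2 * δ) :=
      (norm_mul_le _ _).trans (mul_le_mul_of_nonneg_left hsmall hp0.le)
    have h2 : ‖p‖ * (2 * δ) = ε / 2 := by rw [hδ]; field_simp; norm_num
    have h3 : c * ‖p * (w * a)‖ ≤ ‖p * (w * a)‖ :=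
      mul_le_of_le_one_left (norm_nonneg _) hc2.le
    linarith

/-- The spectrum is covered by finitely many small sets of the form `{φ | 1 / 2 < ‖φ q‖}`, and the
smallness of a product certifies that they cover it. -/
theorem exists_cover [Nontrivial A] {v : A} (hv : ‖v - 1‖ < 1 / 2) (N : ℕ) {ε : ℝ} (hε : 0 < ε) :
    ∃ (L : ℕ) (q : Fin L → RatStarPoly),
      (∀ l, 1 / 2 < ‖P.evalPoly (q l)‖ ∧ ∀ n < N, ∃ z,
        0 < ‖(P.gen n - algebraMap ℂ A (complexOfCode z)) * P.evalPoly (q l)‖ ∧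
        ‖(P.gen n - algebraMap ℂ A (complexOfCode z)) * P.evalPoly (q l)‖ < ε) ∧
      0 < ‖v * ∏ l, (1 - P.evalPoly (q l))‖ ∧
      2 ^ (L + 1) * ‖v * ∏ l, (1 - P.evalPoly (q l))‖ < 1 := by
  set δ := ε / 4 with hδ
  have hδ0 : 0 < δ := by positivity
  choose a ha0 ha1 ha2 using fun φ₀ : characterSpace ℂ A => P.exists_bump φ₀ N hδ0
  choose z hz1 hz2 using fun (φ₀ : characterSpace ℂ A) (n : ℕ) =>
    exists_complexOfCode_near (φ₀ (P.gen n)) hδ0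
  obtain ⟨T, hT⟩ := CompactSpace.elim_nhds_subcover
    (fun φ₀ => {φ : characterSpace ℂ A | φ (a φ₀) = 1}) ha2
  let L := T.card
  let e : Fin L → characterSpace ℂ A := fun l => T.equivFin.symm l
  have hcov (φ : characterSpace ℂ A) : ∃ l, φ (a (e l)) = 1 := by
    have : φ ∈ (⊤ : Set (characterSpace ℂ A)) := trivial
    rw [← hT] at this
    simp only [Set.mem_iUnion] at this
    obtain ⟨φ₀, hφ₀, h⟩ := this
    exact ⟨T.equivFin ⟨φ₀, hφ₀⟩, by simpa [e] using h⟩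
  have hv0 : 0 < ‖v‖ := by
    have := norm_sub_norm_le (1 : A) v
    rw [norm_one, norm_sub_rev] at this
    linarith
  -- The bumps are scaled by `1 - η`. As `η > 0`, no factor `1 - q` vanishes at a character. As `η <
  -- 1 / 2`, each bump keeps norm above 1/2. Every character has some factor equal to `η`, so the
  -- product has norm at most `‖v‖ * η`, which the second bound makes small enough.
  obtain ⟨η, hη0, hη1⟩ := exists_between (show 0 < min (1 / 2) (1 / (2 ^ (L + 1) * ‖v‖)) by
    positivity)
  have hη2 : η < 1 / 2 := hη1.trans_le (min_le_left _ _)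
  have hη3 : 2 ^ (L + 1) * (‖v‖ * η) < 1 := by
    have := hη1.trans_le (min_le_right _ _)
    rw [lt_div_iff₀ (by positivity)] at this
    linarith
  have hc0 : 0 < 1 - η := by linarith
  let w : Fin L → ℕ → A := fun l n => P.gen n - algebraMap ℂ A (complexOfCode (z (e l) n))
  let G : Set (Fin L → A) := {q | (∀ l, 1 / 2 < ‖q l‖ ∧ ∀ n ∈ Finset.range N,
    0 < ‖w l n * q l‖ ∧ ‖w l n * q l‖ < ε) ∧
      0 < ‖v * ∏ l, (1 - q l)‖ ∧ 2 ^ (L + 1) * ‖v * ∏ l, (1 - q l)‖ < 1}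
  have hG : IsOpen G := by
    have h1 : IsOpen {q : Fin L → A | ∀ l, 1 / 2 < ‖q l‖ ∧ ∀ n ∈ Finset.range N,
        0 < ‖w l n * q l‖ ∧ ‖w l n * q l‖ < ε} := by
      simp only [Set.ofPred_forall, Set.ofPred_and]
      refine isOpen_iInter_of_finite fun l => (isOpen_lt (by fun_prop) (by fun_prop)).inter
        (isOpen_biInter_finset fun n _ => (isOpen_lt (by fun_prop) (by fun_prop)).inter
          (isOpen_lt (by fun_prop) (by fun_prop)))
    simp only [G, Set.ofPred_and] at h1 ⊢
    exact h1.inter ((isOpen_lt (by fun_prop) (by fun_prop)).inter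
      (isOpen_lt (by fun_prop) (by fun_prop)))
  have hdense : DenseRange fun (q : Fin L → RatStarPoly) l => P.evalPoly (q l) :=
    DenseRange.piMap fun _ => P.denseRange_evalPoly
  suffices h : (fun l => ((1 - η : ℝ) : ℂ) • a (e l)) ∈ G by
    obtain ⟨q, hq⟩ := hdense.exists_mem_open hG ⟨_, h⟩
    exact ⟨L, q, fun l => ⟨(hq.1 l).1, fun n hn =>
      ⟨z (e l) n, (hq.1 l).2 n (Finset.mem_range.2 hn)⟩⟩, hq.2⟩
  refine ⟨?_, ?_, ?_⟩
  · intro l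
    have hel : e l (a (e l)) = 1 := (ha2 (e l)).self_of_nhds
    refine ⟨lt_of_lt_of_le ?_ (norm_character_apply_le (e l) _), fun n hn => ⟨lt_of_lt_of_le ?_
      (norm_character_apply_le (e l) _), ?_⟩⟩
    · rw [map_smul, hel, norm_smul, Complex.norm_real, Real.norm_of_nonneg hc0.le]
      simp
      linarith
    · rw [map_mul, map_smul, hel, map_sub, character_algebraMap, norm_mul, norm_smul,
        Complex.norm_real, Real.norm_of_nonneg hc0.le]
      have : 0 < ‖(e l) (P.gen n) - complexOfCode (z (e l) n)‖ :=
        norm_pos_iff.2 (sub_ne_zero.2 (hz1 (e l) n).symm)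
      simp only [norm_one]
      positivity
    · have hsmall := P.norm_gen_sub_mul_le (Finset.mem_range.1 hn) (ha0 (e l)) (ha1 (e l)) hδ0.le
        (hz2 (e l) n)
      rw [mul_smul_comm, norm_smul, Complex.norm_real, Real.norm_of_nonneg hc0.le]
      have : (1 - η) * ‖w l n * a (e l)‖ ≤ ‖w l n * a (e l)‖ :=
        mul_le_of_le_one_left (norm_nonneg _) (by linarith)
      have h' : ‖w l n * a (e l)‖ ≤ 2 * δ := hsmall
      linarith
  all_goals
    have hfac (φ : characterSpace ℂ A) (l : Fin L) : ∃ s : ℝ, 0 ≤ s ∧ s ≤ 1 ∧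
        φ (a (e l)) = s ∧ ‖φ (1 - ((1 - η : ℝ) : ℂ) • a (e l))‖ = 1 - (1 - η) * s := by
      obtain ⟨s, hs0, hs1, hs⟩ := ha0 (e l) φ
      refine ⟨s, hs0, hs1, hs, ?_⟩
      have h : (1 : ℂ) - ((1 - η : ℝ) : ℂ) • (s : ℂ) = ((1 - (1 - η) * s : ℝ) : ℂ) := by
        push_cast
        simp
      rw [map_sub, map_one, map_smul, hs, h, Complex.norm_real, Real.norm_of_nonneg]
      nlinarith
  · obtain ⟨φ⟩ : Nonempty (characterSpace ℂ A) := inferInstance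
    refine lt_of_lt_of_le ?_ (norm_character_apply_le φ _)
    rw [map_mul, map_prod, norm_mul, norm_prod]
    refine mul_pos ?_ (Finset.prod_pos fun l _ => ?_)
    · have h1 := norm_character_apply_le φ (v - 1)
      rw [map_sub, map_one, norm_sub_rev] at h1
      have h2 := norm_sub_norm_le (1 : ℂ) (φ v)
      rw [norm_one] at h2
      linarith
    · obtain ⟨s, hs0, hs1, -, h⟩ := hfac φ l
      rw [h]
      nlinarith
  · refine lt_of_le_of_lt (mul_le_mul_of_nonneg_left ?_ (by positivity)) hη3
    refine norm_le_of_forall_character (by positivity) fun φ => ?_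
    rw [map_mul, map_prod, norm_mul, norm_prod]
    refine mul_le_mul (norm_character_apply_le φ v) ?_ (by positivity) (by positivity)
    obtain ⟨l, hl⟩ := hcov φ
    rw [← Finset.mul_prod_erase _ _ (Finset.mem_univ l)]
    have h1 : ‖φ (1 - ((1 - η : ℝ) : ℂ) • a (e l))‖ = η := by
      obtain ⟨s, -, -, hs, h⟩ := hfac φ l
      rw [hl] at hs
      have : s = 1 := by exact_mod_cast hs.symm
      rw [h, this]
      ring
    rw [h1]
    refine mul_le_of_le_one_right hη0.le (Finset.prod_le_one (fun _ _ => norm_nonneg _)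
      fun l' _ => ?_)
    obtain ⟨s, hs0, hs1, -, h⟩ := hfac φ l'
    rw [h]
    nlinarith

end CStarPresentation

/-! ### The algorithm -/

namespace SpectrumAlgorithm

open Encodable OracleMachine

/-- The lower bound of the triple with code `x`. -/
def lower (x : ℕ) : ℕ := x.unpair.1

/-- The index of the triple with code `x`. -/
def index (x : ℕ) : ℕ := x.unpair.2.unpair.1

/-- The upper bound of the triple with code `x`. -/
def upper (x : ℕ) : ℕ := x.unpair.2.unpair.2

/-- The triples with codes in `F` witness that `s` times the norm of the `j`-th rational vector is
less than the number with code `e`. -/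
def UpperBounded (F : List ℕ) (s j e : ℕ) : Prop :=
  ∃ x ∈ F, index x = j ∧ RatCode.Le (RatCode.mul (RatCode.ofNat s) (upper x)) e

/-- The triples with codes in `F` witness that the norm of the `j`-th rational vector is greater
than the number with code `e`. -/
def LowerBounded (F : List ℕ) (j e : ℕ) : Prop :=
  ∃ x ∈ F, index x = j ∧ RatCode.Le e (lower x)

/-- The stages of the approximation of a point: `(r, p, zs)` stands for the set of characters `φ`
with `r ≤ ‖φ p‖`, and `zs` lists the approximations of the values at the generators found so far. -/
abbrev PointState : Type := ℕ × RatStarPoly × List (ℕ × ℕ)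

/-- A multiplier, and the approximate value of a generator. -/
abbrev StepData : Type := RatStarPoly × ℕ × ℕ

/-- The search number `y` is also the length of the prefix of the name that is read. The second
component of `y` is padding that lets this length grow while the data stay fixed. -/
def stepData (y : ℕ) : StepData := ((decode y.unpair.1 : Option StepData)).getD ([], 0, 0)

/-- At stage `k = ⟨n, m⟩`, the data approximate the `n`-th generator up to `2⁻ᵐ`. -/
def StepCheck (F : List ℕ) (s : PointState) (d : StepData) : Prop :=
  UpperBounded F 1 (encode d.1) (RatCode.ofNat 1) ∧
    LowerBounded F (encode (RatStarPoly.mul s.2.1 d.1)) s.1 ∧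
    UpperBounded F (2 ^ s.2.2.length.unpair.2)
      (encode (RatStarPoly.genSubMul s.2.2.length.unpair.1 d.2 (RatStarPoly.mul s.2.1 d.1))) s.1

def nextState (s : PointState) (d : StepData) : PointState :=
  (s.1, RatStarPoly.mul s.2.1 d.1, s.2.2 ++ [d.2])

def initState (x : ℕ) : PointState := (lower x, ratStarPoly (index x), [])

noncomputable def step (f : ℕ → ℕ) (s : PointState) : PointState :=
  nextState s (stepData (sInf {y | StepCheck (initialSegment f y) s (stepData y)}))

noncomputable def pointState (f : ℕ → ℕ) (i K : ℕ) : PointState :=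
  (step f)^[K] (initState (f i))

/-- The code of the approximation up to `2⁻ᴹ` of the `c`-th coordinate. -/
def coordCode (M : ℕ) (zs : List (ℕ × ℕ)) (c : ℕ) : ℕ :=
  if c % 2 = 0 then (zs.getD (Nat.pair (c / 2) M) (0, 0)).1
  else (zs.getD (Nat.pair (c / 2) M) (0, 0)).2

/-- The code of an approximation of the distance, from approximations of the first `N` coordinates
up to `2⁻ᴹ`. -/
def distCode (M : ℕ) (zs zs' : List (ℕ × ℕ)) (N : ℕ) : ℕ :=
  N.rec 0 fun c x => RatCode.add x (RatCode.min (RatCode.invPow c)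
    (RatCode.abs (RatCode.add (coordCode M zs c) (RatCode.neg (coordCode M zs' c)))))

def firstIndex (q : ℕ) : ℕ := q.unpair.2.unpair.1

def secondIndex (q : ℕ) : ℕ := q.unpair.2.unpair.2.unpair.1

/-- The approximate distance is off by at most 4·2⁻ᴺ; a fifth unit turns the non-strict comparisons
of codes into strict inequalities. -/
def errorCode (N : ℕ) : ℕ := RatCode.mul (RatCode.ofNat 5) (RatCode.invPow N)

/-- The approximations `zs` and `zs'` of two points confirm the quadruple with code `q`. -/
def DistCheck (N q : ℕ) (zs zs' : List (ℕ × ℕ)) : Prop :=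
  RatCode.Le (RatCode.add q.unpair.1 (errorCode N)) (distCode (2 * N) zs zs' N) ∧
    RatCode.Le (RatCode.add (distCode (2 * N) zs zs' N) (errorCode N))
      q.unpair.2.unpair.2.unpair.2

instance (N q : ℕ) (zs zs' : List (ℕ × ℕ)) : Decidable (DistCheck N q zs zs') :=
  inferInstanceAs (Decidable (_ ∧ _))

/-- A code of the quadruple `(-1, 0, 0, 1)`. -/
def defaultQuadruple : ℕ :=
  Nat.pair (RatCode.neg (RatCode.ofNat 1)) (Nat.pair 0 (Nat.pair 0 (RatCode.ofNat 1)))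

/-- An enumeration has to output something at every stage. When the check fails it repeats a
quadruple that always holds, since the distance of point 0 to itself is 0. -/
def checkedQuadruple (m : ℕ) (zs zs' : List (ℕ × ℕ)) : ℕ :=
  if DistCheck m.unpair.2 m.unpair.1 zs zs' then m.unpair.1 else defaultQuadruple

/-- A number of stages that suffices for approximating the first `N` coordinates up to `4⁻ᴺ`. -/
def stageBound (N : ℕ) : ℕ := (2 * N + 1) * (2 * N + 1)

/-- The enumeration of the diagram of the spectrum. -/
noncomputable def distName (f : ℕ → ℕ) (m : ℕ) : ℕ :=
  checkedQuadruple m (pointState f (firstIndex m.unpair.1) (stageBound m.unpair.2)).2.2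
    (pointState f (secondIndex m.unpair.1) (stageBound m.unpair.2)).2.2

/-- The product of `v` with `1 - q` for all entries `q` of the name with positions in `l`. -/
def coverPoly (F : List ℕ) (v : RatStarPoly) (l : List ℕ) : RatStarPoly :=
  -- `p (1 - q)` is written as `p - p q`: polynomials have no constant term, and `v` stands in for
  -- the unit.
  l.foldl (fun p i => RatStarPoly.sub p (RatStarPoly.mul p (ratStarPoly (index (F.getD i 0))))) v

/-- The entry `x` of the name defines a set on which the `n`-th generator is almost constant. -/
def SmallCheck (F : List ℕ) (j n x : ℕ) : Prop :=
  -- `k` codes the approximate value of the generator; bounding it by the length of the prefix keeps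
  -- the test primitive recursive.
  ∃ k < F.length, UpperBounded F (2 ^ (2 * j + 6))
    (encode (RatStarPoly.genSubMul n k.unpair (ratStarPoly (index x)))) (lower x)

/-- The last clause certifies that the sets 1/2 < |φ(q)| cover the spectrum. Lower bounds at most
1/2 place these sets inside the regions that contain the corresponding points. -/
def CoverCheck (F : List ℕ) (v : RatStarPoly) (j : ℕ) (l : List ℕ) : Prop :=
  (∀ i ∈ l, i < F.length ∧
      RatCode.Le (RatCode.mul (RatCode.ofNat 2) (lower (F.getD i 0))) (RatCode.ofNat 1) ∧
      ∀ n < j + 2, SmallCheck F j n (F.getD i 0)) ∧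
    UpperBounded F (2 ^ (l.length + 1)) (encode (coverPoly F v l)) (RatCode.ofNat 1)

def listData (y : ℕ) : List ℕ := Denumerable.ofNat (List ℕ) y.unpair.1

/-- The total boundedness function of the spectrum. -/
noncomputable def coverCode (f g : ℕ → ℕ) (j : ℕ) : ℕ :=
  (sInf {y | CoverCheck (initialSegment f y) (ratStarPoly (g 1)) j (listData y)}).unpair.1

/-! ### Primitive recursiveness of the tests -/

section Primrec

open Primrec

variable {α : Type} [Primcodable α]

theorem primrec_lower {f : α → ℕ} (hf : Primrec f) : Primrec fun a => lower (f a) :=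
  RatCode.primrec_numPos hf

theorem primrec_index {f : α → ℕ} (hf : Primrec f) : Primrec fun a => index (f a) :=
  RatCode.primrec_numNeg hf

theorem primrec_upper {f : α → ℕ} (hf : Primrec f) : Primrec fun a => upper (f a) :=
  RatCode.primrec_denPred hf

theorem primrecPred_exists_mem {β : Type} [Primcodable β] {l : α → List β} {p : α → β → Prop}
    (hl : Primrec l) (hp : PrimrecPred fun x : β × α => p x.2 x.1) :
    PrimrecPred fun a => ∃ b ∈ l a, p a b :=
  (PrimrecRel.exists_mem_list (R := fun b a => p a b) hp).comp hl .id

theorem primrecPred_forall_mem {β : Type} [Primcodable β] {l : α → List β} {p : α → β → Prop}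
    (hl : Primrec l) (hp : PrimrecPred fun x : β × α => p x.2 x.1) :
    PrimrecPred fun a => ∀ b ∈ l a, p a b :=
  (PrimrecRel.forall_mem_list (R := fun b a => p a b) hp).comp hl .id

theorem primrecPred_exists_lt {n : α → ℕ} {p : α → ℕ → Prop}
    (hn : Primrec n) (hp : PrimrecPred fun x : ℕ × α => p x.2 x.1) :
    PrimrecPred fun a => ∃ k < n a, p a k :=
  (primrecPred_exists_mem (list_range.comp hn) hp).of_eq fun a => by simp

theorem primrecPred_forall_lt {n : α → ℕ} {p : α → ℕ → Prop}
    (hn : Primrec n) (hp : PrimrecPred fun x : ℕ × α => p x.2 x.1) :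
    PrimrecPred fun a => ∀ k < n a, p a k :=
  (primrecPred_forall_mem (list_range.comp hn) hp).of_eq fun a => by simp

theorem primrecPred_upperBounded {F : α → List ℕ} {s j e : α → ℕ} (hF : Primrec F)
    (hs : Primrec s) (hj : Primrec j) (he : Primrec e) :
    PrimrecPred fun a => UpperBounded (F a) (s a) (j a) (e a) :=
  primrecPred_exists_mem hF <| .and (Primrec.eq.comp (primrec_index fst) (hj.comp snd))
    (RatCode.primrec_le (RatCode.primrec_mul (RatCode.primrec_ofNat (hs.comp snd))
      (primrec_upper fst)) (he.comp snd))

theorem primrecPred_lowerBounded {F : α → List ℕ} {j e : α → ℕ} (hF : Primrec F)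
    (hj : Primrec j) (he : Primrec e) :
    PrimrecPred fun a => LowerBounded (F a) (j a) (e a) :=
  primrecPred_exists_mem hF <| .and (Primrec.eq.comp (primrec_index fst) (hj.comp snd))
    (RatCode.primrec_le (he.comp snd) (primrec_lower fst))

theorem primrec_stepData : Primrec stepData :=
  option_getD.comp (Primrec.decode.comp (fst.comp unpair)) (const _)

theorem primrecPred_stepCheck {F : α → List ℕ} {s : α → PointState} {d : α → StepData}
    (hF : Primrec F) (hs : Primrec s) (hd : Primrec d) :
    PrimrecPred fun a => StepCheck (F a) (s a) (d a) := by
  have hp : Primrec fun a => RatStarPoly.mul (s a).2.1 (d a).1 :=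
    RatStarPoly.primrec_mul (fst.comp (snd.comp hs)) (fst.comp hd)
  have hk : Primrec fun a => (s a).2.2.length.unpair :=
    unpair.comp (list_length.comp (snd.comp (snd.comp hs)))
  exact .and (primrecPred_upperBounded hF (const _) (Primrec.encode.comp (fst.comp hd)) (const _))
    (.and (primrecPred_lowerBounded hF (Primrec.encode.comp hp) (fst.comp hs))
      (primrecPred_upperBounded hF (RatCode.primrec_pow (snd.comp hk))
        (Primrec.encode.comp (RatStarPoly.primrec_genSubMul (fst.comp hk) (snd.comp hd) hp))
        (fst.comp hs)))

theorem primrec_nextState : Primrec₂ nextState :=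
  .mk <| .pair (fst.comp fst) (.pair (RatStarPoly.primrec_mul (fst.comp (snd.comp fst))
    (fst.comp snd)) (list_concat.comp (snd.comp (snd.comp fst)) (snd.comp snd)))

theorem primrec_initState : Primrec initState :=
  .pair (primrec_lower .id) (.pair (RatStarPoly.primrec_ratStarPoly (primrec_index .id)) (const _))

theorem primrec_coordCode {M c : α → ℕ} {zs : α → List (ℕ × ℕ)} (hM : Primrec M)
    (hzs : Primrec zs) (hc : Primrec c) : Primrec fun a => coordCode (M a) (zs a) (c a) := by
  have h : Primrec fun a => (zs a).getD (Nat.pair (c a / 2) (M a)) (0, 0) :=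
    (list_getD (0, 0)).comp hzs (RatCode.primrec_natPair (nat_div.comp hc (const 2)) hM)
  exact ite (Primrec.eq.comp (nat_mod.comp hc (const 2)) (const 0)) (fst.comp h) (snd.comp h)

theorem primrec_distCode {M N : α → ℕ} {zs zs' : α → List (ℕ × ℕ)} (hM : Primrec M)
    (hzs : Primrec zs) (hzs' : Primrec zs') (hN : Primrec N) :
    Primrec fun a => distCode (M a) (zs a) (zs' a) (N a) := by
  have hc : Primrec fun x : α × ℕ × ℕ => x.2.1 := fst.comp snd
  have hs : Primrec₂ fun (a : α) (x : ℕ × ℕ) => RatCode.add x.2 (RatCode.min (RatCode.invPow x.1)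
      (RatCode.abs (RatCode.add (coordCode (M a) (zs a) x.1)
        (RatCode.neg (coordCode (M a) (zs' a) x.1))))) :=
    .mk <| RatCode.primrec_add (snd.comp snd) <| RatCode.primrec_min (RatCode.primrec_invPow hc) <|
      RatCode.primrec_abs <| RatCode.primrec_add
        (primrec_coordCode (hM.comp fst) (hzs.comp fst) hc)
        (RatCode.primrec_neg (primrec_coordCode (hM.comp fst) (hzs'.comp fst) hc))
  have h := nat_rec' (f := N) (g := fun _ => 0) hN (const 0) hs
  exact h.of_eq fun a => rfl

theorem primrec_checkedQuadruple : Primrec fun x : ℕ × List (ℕ × ℕ) × List (ℕ × ℕ) =>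
    checkedQuadruple x.1 x.2.1 x.2.2 := by
  have hq : Primrec fun x : ℕ × List (ℕ × ℕ) × List (ℕ × ℕ) => x.1.unpair.1 :=
    fst.comp (unpair.comp fst)
  have hN : Primrec fun x : ℕ × List (ℕ × ℕ) × List (ℕ × ℕ) => x.1.unpair.2 :=
    snd.comp (unpair.comp fst)
  have hd := primrec_distCode (nat_mul.comp (const 2) hN) (fst.comp snd) (snd.comp snd) hN
  have he := RatCode.primrec_mul (const (RatCode.ofNat 5)) (RatCode.primrec_invPow hN)
  exact ite (.and
      (RatCode.primrec_le (RatCode.primrec_add (RatCode.primrec_numPos hq) he) hd)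
      (RatCode.primrec_le (RatCode.primrec_add hd he)
        (snd.comp (unpair.comp (RatCode.primrec_denPred hq)))))
    hq (const _)

theorem primrec_coverPoly {F : α → List ℕ} {v : α → RatStarPoly} {l : α → List ℕ}
    (hF : Primrec F) (hv : Primrec v) (hl : Primrec l) :
    Primrec fun a => coverPoly (F a) (v a) (l a) := by
  have hs : Primrec₂ fun (a : α) (x : RatStarPoly × ℕ) => RatStarPoly.sub x.1
      (RatStarPoly.mul x.1 (ratStarPoly (index ((F a).getD x.2 0)))) :=
    .mk <| RatStarPoly.primrec_sub (fst.comp snd) <| RatStarPoly.primrec_mul (fst.comp snd) <|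
      RatStarPoly.primrec_ratStarPoly <| primrec_index <|
        (list_getD 0).comp (hF.comp fst) (snd.comp snd)
  exact list_foldl hl hv hs

theorem primrecPred_smallCheck {F : α → List ℕ} {j n x : α → ℕ} (hF : Primrec F)
    (hj : Primrec j) (hn : Primrec n) (hx : Primrec x) :
    PrimrecPred fun a => SmallCheck (F a) (j a) (n a) (x a) :=
  primrecPred_exists_lt (list_length.comp hF) <| primrecPred_upperBounded (hF.comp snd)
    (RatCode.primrec_pow (nat_add.comp (nat_mul.comp (const 2) (hj.comp snd)) (const 6)))
    (Primrec.encode.comp (RatStarPoly.primrec_genSubMul (hn.comp snd) (unpair.comp fst)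
      (RatStarPoly.primrec_ratStarPoly (primrec_index (hx.comp snd)))))
    (primrec_lower (hx.comp snd))

theorem primrecPred_coverCheck {F : α → List ℕ} {v : α → RatStarPoly} {j : α → ℕ}
    {l : α → List ℕ} (hF : Primrec F) (hv : Primrec v) (hj : Primrec j) (hl : Primrec l) :
    PrimrecPred fun a => CoverCheck (F a) (v a) (j a) (l a) := by
  have hx : Primrec fun y : ℕ × α => (F y.2).getD y.1 0 :=
    (list_getD 0).comp (hF.comp snd) fst
  refine .and (primrecPred_forall_mem hl <| .and (nat_lt.comp fst (list_length.comp (hF.comp snd)))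
    (.and (RatCode.primrec_le (RatCode.primrec_mul (const _) (primrec_lower hx)) (const _)) ?_))
    (primrecPred_upperBounded hF (RatCode.primrec_pow (succ.comp (list_length.comp hl)))
      (Primrec.encode.comp (primrec_coverPoly hF hv hl)) (const _))
  exact primrecPred_forall_lt (nat_add.comp (hj.comp snd) (const 2)) <|
    primrecPred_smallCheck (hF.comp (snd.comp snd)) (hj.comp (snd.comp snd)) fst (hx.comp snd)

theorem primrec_listData : Primrec listData := by
  have h : Primrec fun y : ℕ => ((decode y.unpair.1 : Option (List ℕ))).getD [] :=
    option_getD.comp (Primrec.decode.comp (fst.comp unpair)) (const [])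
  exact h.of_eq fun n => by simp [listData]

end Primrec

/-! ### Oracle programs for the searches -/

/-- Search for a number that passes a primitive recursive test against an initial segment of the
even part of the oracle. -/
theorem computableOn_search {α : Type} [Primcodable α] {p : List ℕ → α → ℕ → Prop}
    (hp : PrimrecPred fun x : List ℕ × α × ℕ => p x.1 x.2.1 x.2.2) :
    ComputableOn (fun O a => ∃ y, p (initialSegment (fun i => O (2 * i)) y) a y)
      fun O a => sInf {y | p (initialSegment (fun i => O (2 * i)) y) a y} := by
  classical
  have ht : ComputableOn (fun O (x : α × ℕ) =>
      ∃ y, p (initialSegment (fun i => O (2 * i)) y) x.1 y) fun O (x : α × ℕ) =>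
      if p (initialSegment (fun i => O (2 * i)) x.2) x.1 x.2 then 0 else 1 :=
    .primrec_comp (φ := fun x : List ℕ × α × ℕ => if p x.1 x.2.1 x.2.2 then 0 else 1)
      (.ite hp (.const 0) (.const 1))
      (.pair (computableOn_initialSegment (D := fun _ _ => True) |>.comp (.of_primrec .snd)
        fun _ _ _ => trivial) (.of_primrec .id))
  have hz (q : Prop) [Decidable q] : ((if q then 0 else 1 : ℕ) = 0) = q := by simp
  have := ComputableOn.search (D := fun O a => ∃ y, p (initialSegment (fun i => O (2 * i)) y) a y)
    (t := fun O (x : α × ℕ) =>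
    if p (initialSegment (fun i => O (2 * i)) x.2) x.1 x.2 then 0 else 1) ht
  simp only [hz] at this
  exact this fun _ _ h => h

/-- Asking for success at all iterates, and not only at `s`, makes the domain invariant under
`step`, as iteration requires. -/
theorem computableOn_step :
    ComputableOn (fun O s => ∀ K, ∃ y, StepCheck (initialSegment (fun i => O (2 * i)) y)
      ((step fun i => O (2 * i))^[K] s) (stepData y)) fun O s => step (fun i => O (2 * i)) s :=
  .primrec_comp (φ := fun x : PointState × ℕ => nextState x.1 (stepData x.2))
    (primrec_nextState.comp .fst (primrec_stepData.comp .snd))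
    (.pair (.of_primrec .id) ((computableOn_search (p := fun F s y => StepCheck F s (stepData y))
      (primrecPred_stepCheck .fst (.comp .fst .snd)
        (primrec_stepData.comp (.comp .snd .snd)))).mono fun _ _ h => h 0))

theorem computableOn_pointState :
    ComputableOn (fun O (x : ℕ × ℕ) => ∀ K, ∃ y, StepCheck (initialSegment (fun i => O (2 * i)) y)
      (pointState (fun i => O (2 * i)) x.1 K) (stepData y))
      fun O x => pointState (fun i => O (2 * i)) x.1 x.2 :=
  .iterate (D := fun O i => ∀ K, ∃ y, StepCheck (initialSegment (fun i => O (2 * i)) y)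
      (pointState (fun i => O (2 * i)) i K) (stepData y))
    (init := fun O i => initState (O (2 * i)))
    (.primrec_comp primrec_initState (ComputableOn.oracle (D := fun _ _ => True) |>.comp
      (.of_primrec Primrec.nat_double) fun _ _ _ => trivial))
    computableOn_step (fun _ _ h => h) fun _ _ h K => h (K + 1)

theorem computableOn_distName :
    ComputableOn (fun O (_ : ℕ) => ∀ i K, ∃ y,
      StepCheck (initialSegment (fun i => O (2 * i)) y) (pointState (fun i => O (2 * i)) i K)
        (stepData y)) fun O => distName fun i => O (2 * i) := by
  have hq : Primrec fun m : ℕ => m.unpair.1 := Primrec.fst.comp .unpair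
  have hN : Primrec fun m : ℕ => stageBound m.unpair.2 :=
    have h : Primrec fun m : ℕ => 2 * m.unpair.2 + 1 :=
      Primrec.nat_double_succ.comp (Primrec.snd.comp .unpair)
    Primrec.nat_mul.comp h h
  have hstate {k : ℕ → ℕ} (hk : Primrec k) :
      ComputableOn (fun O (_ : ℕ) => ∀ i K, ∃ y,
        StepCheck (initialSegment (fun i => O (2 * i)) y) (pointState (fun i => O (2 * i)) i K)
          (stepData y))
        fun O m => (pointState (fun i => O (2 * i)) (k m) (stageBound m.unpair.2)).2.2 :=
    .primrec_comp (φ := fun s : PointState => s.2.2) (.comp .snd .snd)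
      (computableOn_pointState.comp (.of_primrec (φ := fun m => (k m, stageBound m.unpair.2))
        (.pair hk hN)) fun _ _ h => h _)
  have h1 := hstate (k := fun m => firstIndex m.unpair.1) (RatCode.primrec_numNeg hq)
  have h2 := hstate (k := fun m => secondIndex m.unpair.1)
    (Primrec.fst.comp (.comp .unpair (RatCode.primrec_denPred hq)))
  have h3 := ComputableOn.pair (.of_primrec Primrec.id) (h1.pair h2)
  have h4 := ComputableOn.primrec_comp primrec_checkedQuadruple h3
  exact h4

/-- Position 3 of the oracle holds `g 1`, the only value of the name of the unit that is used. -/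
theorem computableOn_coverCode :
    ComputableOn (fun O j => ∃ y,
      CoverCheck (initialSegment (fun i => O (2 * i)) y) (ratStarPoly (O 3)) j (listData y))
      fun O => coverCode (fun i => O (2 * i)) fun i => O (2 * i + 1) := by
  have hs := computableOn_search (α := ℕ × ℕ)
    (p := fun F a y => CoverCheck F (ratStarPoly a.1) a.2 (listData y))
    (primrecPred_coverCheck .fst
      (RatStarPoly.primrec_ratStarPoly (.comp .fst (.comp .fst .snd)))
      (.comp .snd (.comp .fst .snd)) (primrec_listData.comp (.comp .snd .snd)))
  have hO : ComputableOn (fun O j => ∃ y, CoverCheck (initialSegment (fun i => O (2 * i)) y)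
      (ratStarPoly (O 3)) j (listData y)) fun O (j : ℕ) => (O 3, j) :=
    .pair (ComputableOn.oracle (D := fun _ _ => True) |>.comp (.of_primrec (.const 3))
      fun _ _ _ => trivial) (.of_primrec .id)
  have h1 := hs.comp hO fun _ _ h => h
  have h2 := ComputableOn.primrec_comp (φ := fun y : ℕ => y.unpair.1) (Primrec.fst.comp .unpair) h1
  exact h2

/-- A single program computes both functions whenever all searches succeed. -/
theorem exists_program : ∃ c : OracleMachine, ∀ f g : ℕ → ℕ,
    (∀ i K, ∃ y, StepCheck (initialSegment f y) (pointState f i K) (stepData y)) →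
    (∀ j, ∃ y, CoverCheck (initialSegment f y) (ratStarPoly (g 1)) j (listData y)) →
    c.Computes (bairePair f g) (bairePair (distName f) (coverCode f g)) := by
  let D : (ℕ → ℕ) → ℕ → Prop := fun O _ =>
    (∀ i K, ∃ y, StepCheck (initialSegment (fun i => O (2 * i)) y)
      (pointState (fun i => O (2 * i)) i K) (stepData y)) ∧
    ∀ j, ∃ y, CoverCheck (initialSegment (fun i => O (2 * i)) y) (ratStarPoly (O 3)) j (listData y)
  have hhalf : Primrec fun n : ℕ => n / 2 := Primrec.nat_div.comp .id (.const 2)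
  have hif : Primrec fun x : ℕ × ℕ × ℕ => if x.1 % 2 = 0 then x.2.1 else x.2.2 :=
    .ite (Primrec.eq.comp (Primrec.nat_mod.comp .fst (.const 2)) (.const 0))
      (.comp .fst .snd) (.comp .snd .snd)
  have h1 : ComputableOn D fun O n => distName (fun i => O (2 * i)) (n / 2) :=
    computableOn_distName.comp (.of_primrec hhalf) fun _ _ h => h.1
  have h2 : ComputableOn D fun O n =>
      coverCode (fun i => O (2 * i)) (fun i => O (2 * i + 1)) (n / 2) :=
    computableOn_coverCode.comp (.of_primrec hhalf) fun _ _ h => h.2 _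
  have h3 := ComputableOn.pair (.of_primrec Primrec.id) (h1.pair h2)
  have h4 := ComputableOn.primrec_comp hif h3
  obtain ⟨c, hc⟩ := h4
  refine ⟨c, fun f g h1 h2 n => ?_⟩
  have hf : (fun i => bairePair f g (2 * i)) = f := funext fun i => by simp [bairePair]
  have hg : (fun i => bairePair f g (2 * i + 1)) = g := funext fun i => by
    rw [bairePair, if_neg (by omega), show (2 * i + 1) / 2 = i by omega]
  have hg' : bairePair f g 3 = g 1 := rfl
  have hD : D (bairePair f g) n := by
    simp only [D, hf, hg']
    exact ⟨h1, h2⟩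
  have h := hc (bairePair f g) n hD
  beta_reduce at h
  rw [hf, hg] at h
  unfold bairePair
  generalize distName f (n / 2) = x at h ⊢
  generalize coverCode f g (n / 2) = y at h ⊢
  exact h

end SpectrumAlgorithm

/-! ### Correctness of the searches -/

namespace SpectrumAlgorithm

open Encodable OracleMachine CStarPresentation

variable {A : Type u} [CommCStarAlgebra A] {P : CStarPresentation A} {f : ℕ → ℕ}

theorem name_sound (hf : P.IsName f) (k : ℕ) :
    0 < ratOfCode (lower (f k)) ∧ (ratOfCode (lower (f k)) : ℝ) < ‖P.ratVec (index (f k))‖ ∧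
      ‖P.ratVec (index (f k))‖ < (ratOfCode (upper (f k)) : ℝ) := by
  have h : tripleOfCode (f k) ∈ P.diagram := by
    rw [hf]
    exact ⟨k, rfl⟩
  exact ⟨h.1, h.2.2⟩

theorem name_complete (hf : P.IsName f) {r r' : ℚ} {j : ℕ} (hr : 0 < r)
    (h : (r : ℝ) < ‖P.ratVec j‖) (h' : ‖P.ratVec j‖ < (r' : ℝ)) :
    ∃ k, ratOfCode (lower (f k)) = r ∧ index (f k) = j ∧ ratOfCode (upper (f k)) = r' := by
  have h0 : 0 < r' := by exact_mod_cast (norm_nonneg _).trans_lt h'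
  have hm : (r, j, r') ∈ P.diagram := ⟨hr, h0, h, h'⟩
  rw [hf] at hm
  obtain ⟨k, hk⟩ := hm
  simp only [tripleOfCode, Prod.mk.injEq] at hk
  exact ⟨k, hk⟩

/-- A name is a total sequence, so the diagram has an element, and its vector has positive norm. -/
theorem nontrivial_of_isName (hf : P.IsName f) : Nontrivial A := by
  obtain ⟨h1, h2, -⟩ := name_sound hf 0
  have : 0 < ‖P.ratVec (index (f 0))‖ := lt_trans (by exact_mod_cast h1) h2
  exact ⟨⟨_, 0, norm_pos_iff.1 this⟩⟩

theorem UpperBounded.norm_lt (hf : P.IsName f) {y s j e : ℕ} (hs : 0 < s)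
    (h : UpperBounded (initialSegment f y) s j e) : s * ‖P.ratVec j‖ < (ratOfCode e : ℝ) := by
  obtain ⟨x, hx, rfl, hle⟩ := h
  obtain ⟨k, -, rfl⟩ := mem_initialSegment.1 hx
  rw [RatCode.le_iff, RatCode.ratOfCode_mul, RatCode.ratOfCode_ofNat] at hle
  have hle' : (s : ℝ) * (ratOfCode (upper (f k)) : ℝ) ≤ (ratOfCode e : ℝ) := by exact_mod_cast hle
  have := (name_sound hf k).2.2
  have hs' : (0 : ℝ) < s := by exact_mod_cast hs
  nlinarith

theorem LowerBounded.lt_norm (hf : P.IsName f) {y j e : ℕ}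
    (h : LowerBounded (initialSegment f y) j e) : (ratOfCode e : ℝ) < ‖P.ratVec j‖ := by
  obtain ⟨x, hx, rfl, hle⟩ := h
  obtain ⟨k, -, rfl⟩ := mem_initialSegment.1 hx
  rw [RatCode.le_iff] at hle
  exact lt_of_le_of_lt (by exact_mod_cast hle) (name_sound hf k).2.1

/-- Positivity of the norm provides the positive lower bound that an entry of the name must have.
The form "for all large `y`" allows several tests to pass on one prefix. -/
theorem eventually_upperBounded (hf : P.IsName f) {s j e : ℕ} (hs : 0 < s)
    (h0 : 0 < ‖P.ratVec j‖) (h : s * ‖P.ratVec j‖ < (ratOfCode e : ℝ)) :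
    ∀ᶠ y in atTop, UpperBounded (initialSegment f y) s j e := by
  have hs' : (0 : ℝ) < s := by exact_mod_cast hs
  obtain ⟨r, hr0, hr⟩ := exists_rat_btwn h0
  obtain ⟨r', hr', he⟩ := exists_rat_btwn ((lt_div_iff₀' hs').2 h)
  obtain ⟨k, -, hj, hk⟩ := name_complete hf (by exact_mod_cast hr0) hr hr'
  filter_upwards [eventually_gt_atTop k] with y hy
  refine ⟨f k, mem_initialSegment.2 ⟨k, hy, rfl⟩, hj, ?_⟩
  rw [RatCode.le_iff, RatCode.ratOfCode_mul, RatCode.ratOfCode_ofNat, hk]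
  rw [lt_div_iff₀' hs'] at he
  exact_mod_cast he.le

theorem eventually_lowerBounded (hf : P.IsName f) {j e : ℕ} (he : 0 < ratOfCode e)
    (h : (ratOfCode e : ℝ) < ‖P.ratVec j‖) :
    ∀ᶠ y in atTop, LowerBounded (initialSegment f y) j e := by
  obtain ⟨r', hr', -⟩ := exists_rat_btwn (lt_add_one ‖P.ratVec j‖)
  obtain ⟨k, hk, hj, -⟩ := name_complete hf he h hr'
  filter_upwards [eventually_gt_atTop k] with y hy
  refine ⟨f k, mem_initialSegment.2 ⟨k, hy, rfl⟩, hj, ?_⟩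
  rw [RatCode.le_iff, hk]

/-! ### The shrinking sets of characters and the dense sequence of points -/

/-- The state describes a nonempty set of characters. -/
def Valid (P : CStarPresentation A) (s : PointState) : Prop :=
  0 < ratOfCode s.1 ∧ (ratOfCode s.1 : ℝ) < ‖P.evalPoly s.2.1‖

/-- The set of characters described by a state. -/
def carrier (P : CStarPresentation A) (s : PointState) : Set (characterSpace ℂ A) :=
  {φ | (ratOfCode s.1 : ℝ) ≤ ‖φ (P.evalPoly s.2.1)‖}

/-- The bound at `φ` is divided by `‖φ p‖`, which is at least `r`. -/
theorem norm_gen_sub_lt {p : A} {r e : ℝ} (hr : 0 < r) {φ : characterSpace ℂ A}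
    (hφ : r ≤ ‖φ p‖) {n : ℕ} {z : ℂ} (h : ‖(P.gen n - algebraMap ℂ A z) * p‖ < e * r) :
    ‖φ (P.gen n) - z‖ < e := by
  have h1 := (norm_character_apply_le φ _).trans_lt h
  rw [map_mul, map_sub, character_algebraMap, norm_mul] at h1
  have h2 := mul_le_mul_of_nonneg_left hφ (norm_nonneg (φ (P.gen n) - z))
  exact lt_of_mul_lt_mul_right (h2.trans_lt h1) hr.le

theorem valid_initState (hf : P.IsName f) (i : ℕ) : Valid P (initState (f i)) :=
  ⟨(name_sound hf i).1, (name_sound hf i).2.1⟩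

theorem exists_stepCheck (hf : P.IsName f) {s : PointState} (hs : Valid P s) :
    ∃ y, StepCheck (initialSegment f y) s (stepData y) := by
  have := nontrivial_of_isName hf
  set n := s.2.2.length.unpair.1
  set m := s.2.2.length.unpair.2
  have hr : (0 : ℝ) < ratOfCode s.1 := by exact_mod_cast hs.1
  obtain ⟨t, z, h1, h2, h3, h4⟩ := P.exists_localizing_multiple hr hs.2 n
    (show 0 < (2 : ℝ)⁻¹ ^ m * ratOfCode s.1 by positivity)
  rw [← evalPoly_mul, ← ratVec_encode] at h2
  rw [← evalPoly_mul, ← evalPoly_genSubMul, ← ratVec_encode] at h3 h4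
  have ht : 0 < ‖P.ratVec (encode t)‖ := by
    rw [ratVec_encode, norm_pos_iff]
    intro ht
    rw [ratVec_encode, evalPoly_mul, ht] at h2
    simp only [mul_zero, norm_zero, not_lt_of_ge hr.le] at h2
  have e1 := eventually_upperBounded (e := RatCode.ofNat 1) hf zero_lt_one ht
    (by simpa [ratVec_encode, RatCode.ratOfCode_ofNat] using h1)
  have e2 := eventually_lowerBounded hf hs.1 h2
  have e3 := eventually_upperBounded (s := 2 ^ m) (e := s.1) hf (by positivity) h3 (by
    rw [inv_pow, inv_mul_eq_div, lt_div_iff₀' (by positivity)] at h4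
    exact_mod_cast h4)
  obtain ⟨M, hM⟩ := eventually_atTop.1 (e1.and (e2.and e3))
  refine ⟨Nat.pair (encode (t, z)) M, ?_⟩
  have hd : stepData (Nat.pair (encode (t, z)) M) = (t, z) := by
    simp only [stepData, Nat.unpair_pair, encodek, Option.getD_some]
  rw [hd]
  exact hM _ (Nat.right_le_pair _ _)

/-- The multiplier has norm below 1, so multiplying by it cannot enlarge `‖φ p‖`; with `r` fixed,
the sets are nested. -/
theorem StepCheck.sound (hf : P.IsName f) {s : PointState} {d : StepData} (hs : Valid P s) {y : ℕ}
    (h : StepCheck (initialSegment f y) s d) :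
    Valid P (nextState s d) ∧ carrier P (nextState s d) ⊆ carrier P s ∧
      ∀ φ ∈ carrier P (nextState s d),
        ‖φ (P.gen s.2.2.length.unpair.1) - complexOfCode d.2‖ <
          (2 : ℝ)⁻¹ ^ s.2.2.length.unpair.2 := by
  have hr : (0 : ℝ) < ratOfCode s.1 := by exact_mod_cast hs.1
  have h1 := h.1.norm_lt hf zero_lt_one
  have h2 := h.2.1.lt_norm hf
  have h3 := h.2.2.norm_lt hf (by positivity)
  rw [ratVec_encode] at h1 h2 h3
  rw [evalPoly_genSubMul] at h3
  simp only [Nat.cast_one, one_mul, RatCode.ratOfCode_ofNat, Rat.cast_one] at h1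
  refine ⟨⟨hs.1, h2⟩, fun φ hφ => ?_, fun φ hφ => norm_gen_sub_lt hr hφ ?_⟩
  · refine le_trans (b := ‖φ (P.evalPoly (nextState s d).2.1)‖) hφ ?_
    rw [nextState, evalPoly_mul, map_mul, norm_mul]
    exact mul_le_of_le_one_right (norm_nonneg _) ((norm_character_apply_le φ _).trans h1.le)
  · rw [inv_pow, inv_mul_eq_div, lt_div_iff₀' (by positivity)]
    exact_mod_cast h3

theorem stepCheck_step (hf : P.IsName f) {s : PointState} (hs : Valid P s) :
    ∃ y d, StepCheck (initialSegment f y) s d ∧ step f s = nextState s d :=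
  ⟨_, _, Nat.sInf_mem (exists_stepCheck hf hs), rfl⟩

theorem pointState_succ (f : ℕ → ℕ) (i K : ℕ) :
    pointState f i (K + 1) = step f (pointState f i K) :=
  Function.iterate_succ_apply' _ _ _

theorem valid_pointState (hf : P.IsName f) (i K : ℕ) : Valid P (pointState f i K) := by
  induction K with
  | zero => exact valid_initState hf i
  | succ K ih =>
    obtain ⟨y, d, h, hd⟩ := stepCheck_step hf ih
    rw [pointState_succ, hd]
    exact (h.sound hf ih).1

theorem carrier_pointState_succ_subset (hf : P.IsName f) (i K : ℕ) :
    carrier P (pointState f i (K + 1)) ⊆ carrier P (pointState f i K) := by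
  obtain ⟨y, d, h, hd⟩ := stepCheck_step hf (valid_pointState hf i K)
  rw [pointState_succ, hd]
  exact (h.sound hf (valid_pointState hf i K)).2.1

theorem length_pointState (f : ℕ → ℕ) (i K : ℕ) : (pointState f i K).2.2.length = K := by
  induction K with
  | zero => rfl
  | succ K ih => rw [pointState_succ, step, nextState, List.length_append, ih, List.length_singleton]

/-- Entries of the list are never revised, and by nestedness each estimate persists at later stages.
-/
theorem norm_gen_sub_lt_of_mem_carrier (hf : P.IsName f) (i K : ℕ) {φ : characterSpace ℂ A}
    (hφ : φ ∈ carrier P (pointState f i K)) {k : ℕ} (hk : k < K) :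
    ‖φ (P.gen k.unpair.1) - complexOfCode ((pointState f i K).2.2.getD k (0, 0))‖ <
      (2 : ℝ)⁻¹ ^ k.unpair.2 := by
  induction K with
  | zero => exact absurd hk k.not_lt_zero
  | succ K ih =>
    obtain ⟨y, d, h, hd⟩ := stepCheck_step hf (valid_pointState hf i K)
    obtain hk' | rfl := Nat.lt_succ_iff_lt_or_eq.1 hk
    · have := ih (carrier_pointState_succ_subset hf i K hφ) hk'
      rw [pointState_succ, hd, nextState, List.getD_append _ _ _ _ (by rwa [length_pointState])]
      exact this
    · rw [pointState_succ, hd] at hφ ⊢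
      have := (h.sound hf (valid_pointState hf i k)).2.2 φ hφ
      rw [length_pointState] at this
      rw [nextState, List.getD_append_right _ _ _ _ (by rw [length_pointState]), length_pointState]
      simpa using this

theorem isClosed_carrier (s : PointState) : IsClosed (carrier P s) :=
  isClosed_le continuous_const (continuous_character_apply _).norm

/-- Cantor's intersection theorem. Only existence is needed: the estimates hold for every character
in the intersection. -/
theorem exists_mem_carrier (hf : P.IsName f) (i : ℕ) :
    ∃ φ, ∀ K, φ ∈ carrier P (pointState f i K) := by
  have := nontrivial_of_isName hf
  obtain ⟨φ, hφ⟩ := IsCompact.nonempty_iInter_of_sequence_nonempty_isCompact_isClosed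
    (fun K => carrier P (pointState f i K)) (carrier_pointState_succ_subset hf i)
    (fun K => by
      obtain ⟨φ, hφ⟩ := exists_norm_character_apply_eq (P.evalPoly (pointState f i K).2.1)
      exact ⟨φ, (valid_pointState hf i K).2.le.trans hφ.ge⟩)
    (isClosed_carrier _).isCompact fun K => isClosed_carrier _
  exact ⟨φ, Set.mem_iInter.1 hφ⟩

/-- The `i`-th point of the presentation of the spectrum. -/
noncomputable def point (hf : P.IsName f) (i : ℕ) : characterSpace ℂ A :=
  (exists_mem_carrier hf i).choose

theorem point_mem_carrier (hf : P.IsName f) (i K : ℕ) :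
    point hf i ∈ carrier P (pointState f i K) :=
  (exists_mem_carrier hf i).choose_spec K

theorem le_norm_point_apply (hf : P.IsName f) (i : ℕ) :
    (ratOfCode (lower (f i)) : ℝ) ≤ ‖point hf i (P.ratVec (index (f i)))‖ :=
  point_mem_carrier hf i 0

/-- A Urysohn function for `φ₀` inside `U` is approximated within 1/2 by a polynomial `p`. Then `‖p‖
> 1 / 2`, so some entry of the name has lower bound 1/2 and polynomial `p`. Its point satisfies
|φ(p)| ≥ 1/2, which is impossible outside `U`. -/
theorem denseRange_point (hf : P.IsName f) : DenseRange (point hf) := by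
  intro φ₀
  rw [mem_closure_iff]
  intro U hU hφ₀
  obtain ⟨g, hg0, hg1, -⟩ := exists_continuous_zero_one_of_isClosed (X := characterSpace ℂ A)
    hU.isClosed_compl isClosed_singleton (Set.disjoint_singleton_right.2 (not_not_intro hφ₀))
  obtain ⟨a, ha⟩ := exists_forall_character_apply_eq (A := A) (f := fun φ => (g φ : ℂ))
    (by fun_prop)
  obtain ⟨p, hp⟩ := Metric.denseRange_iff.1 P.denseRange_evalPoly a (1 / 2) one_half_pos
  rw [dist_eq_norm] at hp
  have hlt : ((1 / 2 : ℚ) : ℝ) < ‖P.ratVec (encode p)‖ := by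
    have h1 := norm_character_apply_le φ₀ (a - P.evalPoly p)
    have h2 : φ₀ a = 1 := by
      rw [ha, hg1 rfl]
      simp
    rw [map_sub, h2] at h1
    have h3 := norm_sub_norm_le (1 : ℂ) (φ₀ (P.evalPoly p))
    have h4 := norm_character_apply_le φ₀ (P.evalPoly p)
    rw [norm_one] at h3
    rw [ratVec_encode]
    push_cast
    linarith
  obtain ⟨r', hr', -⟩ := exists_rat_btwn (lt_add_one ‖P.ratVec (encode p)‖)
  obtain ⟨i, hi, hj, -⟩ := name_complete hf one_half_pos hlt hr'
  refine ⟨_, ?_, i, rfl⟩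
  by_contra hmem
  have h1 := le_norm_point_apply hf i
  rw [hi, hj, ratVec_encode] at h1
  have h2 := norm_character_apply_le (point hf i) (a - P.evalPoly p)
  rw [map_sub, ha, hg0 hmem] at h2
  simp only [Pi.zero_apply, Complex.ofReal_zero, zero_sub, norm_neg] at h2
  push_cast at h1
  linarith

/-! ### Existence and soundness of covers -/

theorem coverPoly_initialSegment {y : ℕ} {l : List ℕ} (hl : ∀ i ∈ l, i < y) (v : RatStarPoly) :
    coverPoly (initialSegment f y) v l =
      l.foldl (fun p i => RatStarPoly.sub p (RatStarPoly.mul p (ratStarPoly (index (f i))))) v := by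
  refine List.foldl_ext _ _ _ fun p i hi => ?_
  rw [getD_initialSegment (hl i hi)]

theorem evalPoly_foldl (P : CStarPresentation A) (f : ℕ → ℕ) (l : List ℕ) (v : RatStarPoly) :
    P.evalPoly (l.foldl
      (fun p i => RatStarPoly.sub p (RatStarPoly.mul p (ratStarPoly (index (f i))))) v) =
      P.evalPoly v * (l.map fun i => 1 - P.ratVec (index (f i))).prod := by
  induction l generalizing v with
  | nil => simp
  | cons i l ih =>
    rw [List.foldl_cons, ih, evalPoly_sub, evalPoly_mul, List.map_cons, List.prod_cons, ← mul_assoc,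
      mul_sub, mul_one]
    rfl

theorem exists_coverCheck (hf : P.IsName f) {v : ℕ} (hv : ‖P.ratVec v - 1‖ < 1 / 2) (j : ℕ) :
    ∃ y, CoverCheck (initialSegment f y) (ratStarPoly v) j (listData y) := by
  have := nontrivial_of_isName hf
  -- The factor 1/2 is the lower bound of the entries chosen below, relative to which `SmallCheck`
  -- measures its tolerance.
  obtain ⟨L, q, hq, h0, h1⟩ := P.exists_cover hv (j + 2)
    (show (0 : ℝ) < 2⁻¹ ^ (2 * j + 6) * (1 / 2) by positivity)
  have hi (l : Fin L) : ∃ i, ratOfCode (lower (f i)) = 1 / 2 ∧ index (f i) = encode (q l) := by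
    obtain ⟨r', hr', -⟩ := exists_rat_btwn (lt_add_one ‖P.ratVec (encode (q l))‖)
    obtain ⟨i, h1, h2, -⟩ := name_complete hf one_half_pos
      (by rw [ratVec_encode]; push_cast; exact (hq l).1) hr'
    exact ⟨i, h1, h2⟩
  choose i hi1 hi2 using hi
  have hpoly (l : Fin L) : ratStarPoly (index (f (i l))) = q l := by
    rw [hi2, ratStarPoly, Denumerable.ofNat_encode]
  let p : RatStarPoly := (List.ofFn i).foldl
    (fun p i => RatStarPoly.sub p (RatStarPoly.mul p (ratStarPoly (index (f i))))) (ratStarPoly v)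
  have hp : P.ratVec (encode p) = P.ratVec v * ∏ l, (1 - P.evalPoly (q l)) := by
    rw [ratVec_encode, evalPoly_foldl, List.map_ofFn, List.prod_ofFn]
    congr 1
    refine Finset.prod_congr rfl fun l _ => ?_
    rw [Function.comp_apply, ratVec, hpoly]
  have hsmall (l : Fin L) (n : ℕ) (hn : n ∈ Finset.range (j + 2)) :
      ∀ᶠ y in atTop, SmallCheck (initialSegment f y) j n (f (i l)) := by
    obtain ⟨z, hz0, hz1⟩ := (hq l).2 n (Finset.mem_range.1 hn)
    rw [← evalPoly_genSubMul, ← ratVec_encode] at hz0 hz1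
    have := eventually_upperBounded (s := 2 ^ (2 * j + 6)) (e := lower (f (i l))) hf
      (by positivity) hz0 (by
        rw [inv_pow, inv_mul_eq_div, lt_div_iff₀' (by positivity)] at hz1
        rw [hi1]
        push_cast
        exact hz1)
    filter_upwards [this, eventually_gt_atTop (Nat.pair z.1 z.2)] with y hy hyz
    refine ⟨Nat.pair z.1 z.2, by rwa [length_initialSegment], ?_⟩
    rwa [Nat.unpair_pair, hpoly]
  have hup := eventually_upperBounded (s := 2 ^ (L + 1)) (j := encode p) (e := RatCode.ofNat 1) hf
    (by positivity) (by rwa [hp]) (by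
      rw [hp, RatCode.ratOfCode_ofNat]
      push_cast
      exact h1)
  have hall : ∀ᶠ y in atTop, CoverCheck (initialSegment f y) (ratStarPoly v) j (List.ofFn i) := by
    filter_upwards [hup, eventually_all.2 fun l => eventually_gt_atTop (i l),
      eventually_all.2 fun l => (Finset.eventually_all (Finset.range (j + 2))).2 (hsmall l)]
      with y hy hlt hs
    have hlt' : ∀ k ∈ List.ofFn i, k < y := fun k hk => by
      obtain ⟨l, rfl⟩ := List.mem_ofFn.1 hk
      exact hlt l
    refine ⟨fun k hk => ?_, ?_⟩
    · rw [length_initialSegment, getD_initialSegment (hlt' k hk)]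
      obtain ⟨l, rfl⟩ := List.mem_ofFn.1 hk
      refine ⟨hlt l, ?_, fun n hn => hs l n (Finset.mem_range.2 hn)⟩
      rw [RatCode.le_iff, RatCode.ratOfCode_mul, RatCode.ratOfCode_ofNat, RatCode.ratOfCode_ofNat,
        hi1]
      norm_num
    · rw [List.length_ofFn, coverPoly_initialSegment hlt']
      exact hy
  obtain ⟨M, hM⟩ := eventually_atTop.1 hall
  refine ⟨Nat.pair (encode (List.ofFn i)) M, ?_⟩
  rw [show listData (Nat.pair (encode (List.ofFn i)) M) = List.ofFn i by simp [listData]]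
  exact hM _ (Nat.right_le_pair _ _)

/-- Were all `‖φ q‖ ≤ 1 / 2`, each factor `1 - q` and also `v` would have modulus at least 1/2 at
`φ`, against the certified bound. For an entry with `‖φ q‖ > 1 / 2`, both `φ` and its point lie
where each generator is close to one common value. -/
theorem CoverCheck.exists_near (hf : P.IsName f) {v : ℕ} (hv : ‖P.ratVec v - 1‖ < 1 / 2) {j y : ℕ}
    {l : List ℕ} (h : CoverCheck (initialSegment f y) (ratStarPoly v) j l)
    (φ : characterSpace ℂ A) :
    ∃ i ∈ l, ∀ n < j + 2,
      ‖φ (P.gen n) - point hf i (P.gen n)‖ < 2 * (2 : ℝ)⁻¹ ^ (2 * j + 6) := by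
  obtain ⟨h1, h2⟩ := h
  rw [length_initialSegment] at h1
  have h3 := h2.norm_lt hf (by positivity)
  rw [coverPoly_initialSegment fun i hi => (h1 i hi).1, ratVec_encode, evalPoly_foldl] at h3
  have hφ : ∃ i ∈ l, 1 / 2 < ‖φ (P.ratVec (index (f i)))‖ := by
    by_contra! hc
    have hprod : (2 : ℝ)⁻¹ ^ l.length ≤
        ‖φ (l.map fun i => 1 - P.ratVec (index (f i))).prod‖ := by
      clear h1 h2 h3
      induction l with
      | nil => simp
      | cons i l ih =>
        have h4 := norm_sub_norm_le (1 : ℂ) (φ (P.ratVec (index (f i))))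
        have h5 := hc i List.mem_cons_self
        rw [norm_one] at h4
        rw [List.map_cons, List.prod_cons, map_mul, norm_mul, map_sub, map_one, List.length_cons,
          pow_succ']
        exact mul_le_mul (by linarith) (ih fun k hk => hc k (List.mem_cons_of_mem _ hk))
          (by positivity) (norm_nonneg _)
    have hv' : (2 : ℝ)⁻¹ ≤ ‖φ (P.evalPoly (ratStarPoly v))‖ := by
      have h4 := norm_character_apply_le φ (P.ratVec v - 1)
      rw [map_sub, map_one, norm_sub_rev] at h4
      have h5 := norm_sub_norm_le (1 : ℂ) (φ (P.ratVec v))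
      rw [norm_one] at h5
      have : 2⁻¹ ≤ ‖φ (P.ratVec v)‖ := by linarith
      exact this
    have h4 := norm_character_apply_le φ
      (P.evalPoly (ratStarPoly v) * (l.map fun i => 1 - P.ratVec (index (f i))).prod)
    rw [map_mul, norm_mul] at h4
    have h5 := mul_le_mul hv' hprod (by positivity) (norm_nonneg _)
    have h6 := mul_le_mul_of_nonneg_left (h5.trans h4) (show (0 : ℝ) ≤ 2 ^ (l.length + 1) by
      positivity)
    have h7 : (2 : ℝ) ^ (l.length + 1) * (2⁻¹ * 2⁻¹ ^ l.length) = 1 := by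
      rw [← pow_succ', ← mul_pow]
      norm_num
    rw [h7] at h6
    simp only [RatCode.ratOfCode_ofNat] at h3
    push_cast at h3
    linarith
  obtain ⟨i, hi, hlt⟩ := hφ
  refine ⟨i, hi, fun n hn => ?_⟩
  obtain ⟨hiy, hr, hs⟩ := h1 i hi
  rw [getD_initialSegment hiy] at hr hs
  rw [RatCode.le_iff, RatCode.ratOfCode_mul, RatCode.ratOfCode_ofNat, RatCode.ratOfCode_ofNat] at hr
  have hr' : 2 * (ratOfCode (lower (f i)) : ℝ) ≤ 1 := by exact_mod_cast hr
  obtain ⟨k, -, hk⟩ := hs n hn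
  have hk' := hk.norm_lt hf (by positivity)
  rw [ratVec_encode, evalPoly_genSubMul] at hk'
  have hsm : ‖(P.gen n - algebraMap ℂ A (complexOfCode k.unpair)) * P.ratVec (index (f i))‖ <
      (2 : ℝ)⁻¹ ^ (2 * j + 6) * ratOfCode (lower (f i)) := by
    rw [inv_pow, inv_mul_eq_div, lt_div_iff₀' (by positivity)]
    exact_mod_cast hk'
  have hr0 : (0 : ℝ) < ratOfCode (lower (f i)) := by exact_mod_cast (name_sound hf i).1
  have ha := norm_gen_sub_lt hr0 (φ := φ) (by linarith) hsm
  have hb := norm_gen_sub_lt hr0 (le_norm_point_apply hf i) hsm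
  rw [norm_sub_rev] at hb
  have := norm_sub_le_norm_sub_add_norm_sub (φ (P.gen n)) (complexOfCode k.unpair)
    (point hf i (P.gen n))
  linarith

/-! ### The metric on the spectrum and total boundedness -/

/-- The real and imaginary parts of the values of a character at the generators. -/
noncomputable def coord (P : CStarPresentation A) (φ : characterSpace ℂ A) (c : ℕ) : ℝ :=
  if c % 2 = 0 then (φ (P.gen (c / 2))).re else (φ (P.gen (c / 2))).im

/-- A continuous injection of a compact space into a Hausdorff space is an embedding. -/
theorem isEmbedding_coord (P : CStarPresentation A) : IsEmbedding (coord P) := by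
  have hc : Continuous (coord P) := continuous_pi fun c => by
    unfold coord
    split_ifs
    · exact Complex.continuous_re.comp (continuous_character_apply _)
    · exact Complex.continuous_im.comp (continuous_character_apply _)
  refine (hc.isClosedEmbedding fun φ ψ h => P.character_ext fun n => Complex.ext ?_ ?_).isEmbedding
  · simpa [coord] using congrFun h (2 * n)
  · have := congrFun h (2 * n + 1)
    simpa only [coord, if_neg (show ¬(2 * n + 1) % 2 = 0 by omega),
      show (2 * n + 1) / 2 = n by omega] using this

/-- The presentation of the spectrum that the algorithm computes. -/
noncomputable def presentation (hf : P.IsName f) : SpacePresentation (characterSpace ℂ A) where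
  metric := @IsEmbedding.comapMetricSpace _ _ _ PiCountable.metricSpace _ (isEmbedding_coord P)
  compatible := rfl
  complete :=
    -- Completeness comes from compactness of the spectrum.
    letI := @IsEmbedding.comapMetricSpace _ _ _ PiCountable.metricSpace _ (isEmbedding_coord P)
    (inferInstance : CompleteSpace (characterSpace ℂ A))
  point := point hf
  dense_point := denseRange_point hf

/-- The neglected tail is dominated by a geometric series with sum 2·2⁻ᴺ. -/
theorem abs_presentation_d_sub_le (hf : P.IsName f) (φ ψ : characterSpace ℂ A) (N : ℕ) :
    |(presentation hf).d φ ψ -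
      ∑ c ∈ Finset.range N, (min ((2 : ℝ)⁻¹ ^ c) |coord P φ c - coord P ψ c|)| ≤
      2 * (2 : ℝ)⁻¹ ^ N := by
  set t : ℕ → ℝ := fun c => min ((2 : ℝ)⁻¹ ^ c) |coord P φ c - coord P ψ c| with ht
  have ht0 (c : ℕ) : 0 ≤ t c := le_min (by positivity) (abs_nonneg _)
  have hg : Summable fun c : ℕ => (2 : ℝ)⁻¹ ^ c :=
    summable_geometric_of_lt_one (by norm_num) (by norm_num)
  have hs : Summable t := .of_nonneg_of_le ht0 (fun c => min_le_left _ _) hg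
  have hd : (presentation hf).d φ ψ = ∑' c, t c := rfl
  rw [hd, ← hs.sum_add_tsum_nat_add N, add_sub_cancel_left,
    abs_of_nonneg (tsum_nonneg fun _ => ht0 _)]
  have h1 : ∑' c, t (c + N) ≤ ∑' c : ℕ, (2 : ℝ)⁻¹ ^ (c + N) :=
    ((summable_nat_add_iff N).2 hs).tsum_le_tsum (fun c => min_le_left _ _)
      ((summable_nat_add_iff N).2 hg)
  refine h1.trans_eq ?_
  simp only [pow_add]
  rw [tsum_mul_right, tsum_geometric_of_lt_one (by norm_num) (by norm_num)]
  norm_num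

theorem abs_coord_sub_le (φ ψ : characterSpace ℂ A) (c : ℕ) :
    |coord P φ c - coord P ψ c| ≤ ‖φ (P.gen (c / 2)) - ψ (P.gen (c / 2))‖ := by
  unfold coord
  split_ifs
  · exact Complex.abs_re_le_norm (φ (P.gen (c / 2)) - ψ (P.gen (c / 2)))
  · exact Complex.abs_im_le_norm (φ (P.gen (c / 2)) - ψ (P.gen (c / 2)))

theorem natCast_mul_pow_le_one (N : ℕ) : (N : ℝ) * 2⁻¹ ^ N ≤ 1 := by
  rw [inv_pow, ← div_eq_mul_inv, div_le_one (by positivity)]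
  exact_mod_cast Nat.lt_two_pow_self.le

/-- Truncation after `j + 2` coordinates costs 2⁻ʲ/2, and these coordinates contribute at most (j +
2)·2·2^-(2j+6) ≤ 2⁻ʲ/8. This explains the constants in `CoverCheck` and `SmallCheck`. -/
theorem isTotalBoundednessFunction_coverCode (hf : P.IsName f) {g : ℕ → ℕ}
    (hv : ‖P.ratVec (g 1) - 1‖ < 1 / 2) :
    (presentation hf).IsTotalBoundednessFunction (coverCode f g) := by
  intro j φ
  have hcheck : CoverCheck _ _ _ _ := Nat.sInf_mem (exists_coverCheck hf hv j)
  obtain ⟨i, hi, h⟩ := hcheck.exists_near hf hv φ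
  refine ⟨i, List.mem_toFinset.2 hi, ?_⟩
  have h1 := (abs_le.1 (abs_presentation_d_sub_le hf φ (point hf i) (j + 2))).2
  have h2 : ∑ c ∈ Finset.range (j + 2),
      min ((2 : ℝ)⁻¹ ^ c) |coord P φ c - coord P (point hf i) c| ≤
      ∑ c ∈ Finset.range (j + 2), 2 * (2 : ℝ)⁻¹ ^ (2 * j + 6) :=
    Finset.sum_le_sum fun c hc => (min_le_right _ _).trans ((abs_coord_sub_le _ _ _).trans
      (h _ ((Nat.div_le_self _ _).trans_lt (Finset.mem_range.1 hc))).le)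
  rw [Finset.sum_const, Finset.card_range, nsmul_eq_mul] at h2
  have h3 := natCast_mul_pow_le_one (j + 2)
  have h4 : (((j + 2 : ℕ) : ℝ) * (2 * (2 : ℝ)⁻¹ ^ (2 * j + 6))) =
      (((j + 2 : ℕ) : ℝ) * 2⁻¹ ^ (j + 2)) * (2⁻¹ ^ j * (1 / 8)) := by
    rw [show 2 * j + 6 = (j + 2) + j + 4 by ring, pow_add, pow_add]
    ring
  have h5 : (2 : ℝ)⁻¹ ^ (j + 2) = 2⁻¹ ^ j * (1 / 4) := by
    rw [pow_add]
    norm_num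
  have h6 : (0 : ℝ) < 2⁻¹ ^ j := by positivity
  have h7 := mul_le_mul_of_nonneg_right h3 (show (0 : ℝ) ≤ 2⁻¹ ^ j * (1 / 8) by positivity)
  rw [h4] at h2
  change (presentation hf).d φ (point hf i) < _
  linarith

/-! ### Approximation of distances and the name of the spectrum -/

theorem ratOfCode_distCode (M : ℕ) (zs zs' : List (ℕ × ℕ)) (N : ℕ) :
    ratOfCode (distCode M zs zs' N) = ∑ c ∈ Finset.range N, min ((2 : ℚ)⁻¹ ^ c)
      |ratOfCode (coordCode M zs c) - ratOfCode (coordCode M zs' c)| := by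
  induction N with
  | zero => exact RatCode.ratOfCode_zero
  | succ N ih =>
    rw [Finset.sum_range_succ, ← ih, sub_eq_add_neg, ← RatCode.ratOfCode_neg,
      ← RatCode.ratOfCode_add, ← RatCode.ratOfCode_abs, ← RatCode.ratOfCode_invPow,
      ← RatCode.ratOfCode_min, ← RatCode.ratOfCode_add]
    rfl

theorem abs_coord_point_sub_le (hf : P.IsName f) (i : ℕ) {N c : ℕ} (hc : c < N) :
    |coord P (point hf i) c -
      (ratOfCode (coordCode (2 * N) (pointState f i (stageBound N)).2.2 c) : ℝ)| ≤
      (2 : ℝ)⁻¹ ^ (2 * N) := by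
  have hk : Nat.pair (c / 2) (2 * N) < stageBound N := by
    -- Since `c / 2 < 2 * N`, the pair is (2N)² + c/2, which is below (2N + 1)².
    rw [Nat.pair, if_pos (by omega), stageBound]
    have : c / 2 ≤ c := Nat.div_le_self _ _
    nlinarith
  have h := (norm_gen_sub_lt_of_mem_carrier hf i (stageBound N) (point_mem_carrier hf i _) hk).le
  rw [Nat.unpair_pair] at h
  unfold coord coordCode
  split_ifs
  · refine (le_of_eq ?_).trans ((Complex.abs_re_le_norm _).trans h)
    simp [complexOfCode]
  · refine (le_of_eq ?_).trans ((Complex.abs_im_le_norm _).trans h)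
    simp [complexOfCode]

/-- Half of the error is truncation. The other half comes from N coordinate differences, each off by
at most 2·4⁻ᴺ, together with N·2⁻ᴺ ≤ 1. -/
theorem abs_d_point_sub_le (hf : P.IsName f) (i k N : ℕ) :
    |(presentation hf).d (point hf i) (point hf k) -
      (ratOfCode (distCode (2 * N) (pointState f i (stageBound N)).2.2
        (pointState f k (stageBound N)).2.2 N) : ℝ)| ≤ 4 * (2 : ℝ)⁻¹ ^ N := by
  have h1 := abs_presentation_d_sub_le hf (point hf i) (point hf k) N
  set x : ℕ → ℝ := fun c => ratOfCode (coordCode (2 * N) (pointState f i (stageBound N)).2.2 c)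
  set x' : ℕ → ℝ := fun c => ratOfCode (coordCode (2 * N) (pointState f k (stageBound N)).2.2 c)
  have h2 : |∑ c ∈ Finset.range N, min ((2 : ℝ)⁻¹ ^ c)
      |coord P (point hf i) c - coord P (point hf k) c| -
      ∑ c ∈ Finset.range N, (min ((2 : ℝ)⁻¹ ^ c) |x c - x' c|)| ≤
      ∑ c ∈ Finset.range N, 2 * (2 : ℝ)⁻¹ ^ (2 * N) := by
    rw [← Finset.sum_sub_distrib]
    refine (Finset.abs_sum_le_sum_abs _ _).trans (Finset.sum_le_sum fun c hc => ?_)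
    have ha := abs_coord_point_sub_le hf i (Finset.mem_range.1 hc)
    have hb := abs_coord_point_sub_le hf k (Finset.mem_range.1 hc)
    refine (abs_min_sub_min_le_max _ _ _ _).trans ?_
    rw [sub_self, abs_zero]
    refine max_le (by positivity) ((abs_abs_sub_abs_le _ _).trans ?_)
    have : coord P (point hf i) c - coord P (point hf k) c - (x c - x' c) =
      (coord P (point hf i) c - x c) - (coord P (point hf k) c - x' c) := by ring
    rw [this]
    refine (abs_sub _ _).trans ?_
    linarith
  rw [Finset.sum_const, Finset.card_range, nsmul_eq_mul, two_mul N, pow_add] at h2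
  have h3 := natCast_mul_pow_le_one N
  have h4 : (0 : ℝ) < 2⁻¹ ^ N := by positivity
  have h5 : (N : ℝ) * (2 * (2⁻¹ ^ N * 2⁻¹ ^ N)) ≤ 2 * 2⁻¹ ^ N := by nlinarith
  rw [ratOfCode_distCode]
  push_cast
  refine (abs_sub_le _ _ _).trans ((add_le_add h1 (h2.trans h5)).trans_eq ?_)
  ring

theorem presentation_point (hf : P.IsName f) (i : ℕ) : (presentation hf).point i = point hf i :=
  rfl

theorem quadrupleOfCode_mem_diagram (hf : P.IsName f) (q : ℕ) :
    SpacePresentation.quadrupleOfCode q ∈ (presentation hf).diagram ↔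
      (ratOfCode q.unpair.1 : ℝ) <
        (presentation hf).d (point hf (firstIndex q)) (point hf (secondIndex q)) ∧
      (presentation hf).d (point hf (firstIndex q)) (point hf (secondIndex q)) <
        (ratOfCode q.unpair.2.unpair.2.unpair.2 : ℝ) := by
  rw [← presentation_point, ← presentation_point]
  rfl

theorem isName_distName (hf : P.IsName f) : (presentation hf).IsName (distName f) := by
  have he (N : ℕ) : ((ratOfCode (errorCode N) : ℚ) : ℝ) = 5 * 2⁻¹ ^ N := by
    rw [errorCode, RatCode.ratOfCode_mul, RatCode.ratOfCode_ofNat, RatCode.ratOfCode_invPow]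
    push_cast
    rfl
  ext ⟨r, j, k, r'⟩
  constructor
  · rintro ⟨h1, h2⟩
    change (r : ℝ) < (presentation hf).d (point hf j) (point hf k) at h1
    change (presentation hf).d (point hf j) (point hf k) < (r' : ℝ) at h2
    obtain ⟨a, rfl⟩ := RatCode.ratOfCode_surjective r
    obtain ⟨b, rfl⟩ := RatCode.ratOfCode_surjective r'
    -- The check needs slack 9·2⁻ᴺ on each side: five for `errorCode` and four for the
    -- approximation. Ten suffices.
    obtain ⟨N, hN⟩ := exists_pow_lt_of_lt_one (y := (2 : ℝ)⁻¹)
      (show 0 < min ((presentation hf).d (point hf j) (point hf k) - ratOfCode a)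
        (ratOfCode b - (presentation hf).d (point hf j) (point hf k)) / 10 from
        div_pos (lt_min (sub_pos.2 h1) (sub_pos.2 h2)) (by norm_num)) (by norm_num)
    rw [lt_div_iff₀ (by norm_num), lt_min_iff] at hN
    have h := abs_le.1 (abs_d_point_sub_le hf j k N)
    refine ⟨Nat.pair (Nat.pair a (Nat.pair j (Nat.pair k b))) N, ?_⟩
    have hcheck : DistCheck N (Nat.pair a (Nat.pair j (Nat.pair k b)))
        (pointState f j (stageBound N)).2.2 (pointState f k (stageBound N)).2.2 := by
      have h4 : (0 : ℝ) < 2⁻¹ ^ N := by positivity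
      simp only [DistCheck, Nat.unpair_pair, RatCode.le_iff, RatCode.ratOfCode_add]
      constructor
      · rw [← Rat.cast_le (K := ℝ), Rat.cast_add, he]
        linarith
      · rw [← Rat.cast_le (K := ℝ), Rat.cast_add, he]
        linarith
    simp only [distName, checkedQuadruple, firstIndex, secondIndex, Nat.unpair_pair,
      if_pos hcheck, SpacePresentation.quadrupleOfCode]
  · rintro ⟨m, hm⟩
    rw [← hm, distName, checkedQuadruple]
    split_ifs with hcheck
    · have h := abs_le.1 (abs_d_point_sub_le hf (firstIndex m.unpair.1) (secondIndex m.unpair.1)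
        m.unpair.2)
      have h4 : (0 : ℝ) < 2⁻¹ ^ m.unpair.2 := by positivity
      obtain ⟨h1, h2⟩ := hcheck
      rw [RatCode.le_iff, RatCode.ratOfCode_add, ← Rat.cast_le (K := ℝ), Rat.cast_add, he] at h1 h2
      generalize distCode _ _ _ _ = D at h h1 h2
      have h5 : (ratOfCode m.unpair.1.unpair.1 : ℝ) < (presentation hf).d
          (point hf (firstIndex m.unpair.1)) (point hf (secondIndex m.unpair.1)) := by
        linarith
      have h6 : (presentation hf).d (point hf (firstIndex m.unpair.1))
          (point hf (secondIndex m.unpair.1)) <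
          (ratOfCode m.unpair.1.unpair.2.unpair.2.unpair.2 : ℝ) := by
        linarith
      exact (quadrupleOfCode_mem_diagram hf _).2 ⟨h5, h6⟩
    · have hd : (presentation hf).d (point hf 0) (point hf 0) = 0 :=
        (presentation hf).metric.dist_self _
      rw [quadrupleOfCode_mem_diagram]
      simp only [defaultQuadruple, firstIndex, secondIndex, Nat.unpair_pair, RatCode.ratOfCode_neg,
        RatCode.ratOfCode_ofNat, hd]
      norm_num

end SpectrumAlgorithm

theorem mainTheorem2 :
    ∃ c : OracleMachine, ∀ (A : Type u) [CommCStarAlgebra A] (P : CStarPresentation A)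
      (f g : ℕ → ℕ), P.IsName f → P.IsVectorName (1 : A) g →
        ∃ (Q : SpacePresentation (WeakDual.characterSpace ℂ A)) (h b : ℕ → ℕ),
          c.Computes (bairePair f g) (bairePair h b) ∧
            Q.IsName h ∧ Q.IsTotalBoundednessFunction b := by
  obtain ⟨c, hc⟩ := SpectrumAlgorithm.exists_program
  refine ⟨c, fun A _ P f g hf hg => ?_⟩
  have hv : ‖P.ratVec (g 1) - 1‖ < 1 / 2 := by simpa using hg 1
  exact ⟨SpectrumAlgorithm.presentation hf, _, _,
    hc f g (fun i K => SpectrumAlgorithm.exists_stepCheck hf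
        (SpectrumAlgorithm.valid_pointState hf i K))
      (SpectrumAlgorithm.exists_coverCheck hf hv),
    SpectrumAlgorithm.isName_distName hf,
    SpectrumAlgorithm.isTotalBoundednessFunction_coverCode hf hv⟩
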